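/- Let $\mathcal{M}$ be the set of all discrete random variables on the probability space $[0,1]$ with Lebesgue measure, i.e. of all Lebesgue measurable functions $X:[0,1]\to\{1,2,3,\ldots\}$. The first-order theory of random variables with probabilistic independence (FOTPI) concerns first-order formulae whose variables range over $\mathcal{M}$ and whose only atomic formulae are independence statements $X\perp\!\!\!\perp Y$ between two random variables (no equality symbol and no constants are used); the logical operators and the quantifiers have their usual meaning in the structure $(\mathcal{M},\perp\!\!\!\perp)$. For $\theta\in[0,1/2]$, let $\mathrm{Bern}(\theta)$ be the distribution with mass $\theta$ at $1$ and mass $1-\theta$ at $0$. Call $\theta$ Bernoulli-definable in FOTPI if there is such a formula $P(X)$ with one free variable such that, for every $X\in\mathcal{M}$, $P(X)$ holds in $(\mathcal{M},\perp\!\!\!\perp)$ if and only if $X\sim\mathrm{Bern}(\theta)$ up to relabelling, i.e. there is a function $f$, injective on the set of values that $X$ takes with positive probability, such that $f(X)\sim\mathrm{Bern}(\theta)$. Call $\theta$ arithmetically definable if the set $\{(a,b)\in\mathbb{N}^2 : a\ge 1,\ b\ge 1,\ a/b\le\theta\}$ is definable by a parameter-free first-order formula in the structure $(\mathbb{N},+,\cdot,<)$,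 where $\mathbb{N}=\{0,1,2,\ldots\}$. **Theorem.** Every arithmetically definable real number $\theta\in[0,1/2]$ is Bernoulli-definable in FOTPI. -/

import Mathlib

noncomputable section

namespace FOTPI

open MeasureTheory ProbabilityTheory FirstOrder FirstOrder.Language

/-! ### First-order arithmetic: the structure `(ℕ, +, ·, <)` -/

/-- The function symbols of first-order arithmetic: two binary symbols `+` and `·`. -/
inductive ArithFunc : ℕ → Type
  | add : ArithFunc 2
  | mul : ArithFunc 2

/-- The relation symbols of first-order arithmetic (besides equality): one binary symbol `<`. -/
inductive ArithRel : ℕ → Type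
  | lt : ArithRel 2

/-- The first-order language `{+, ·, <}` (with equality). -/
def arith : Language := ⟨ArithFunc, ArithRel⟩

/-- The standard model of arithmetic, with universe `ℕ = {0, 1, 2, …}`. -/
instance arithStructure : arith.Structure ℕ where
  funMap
    | .add, v => v 0 + v 1
    | .mul, v => v 0 * v 1
  RelMap
    | .lt, v => v 0 < v 1

/-- A real `θ` is arithmetically definable if the set of pairs `(a, b)` of positive integers with
`a / b ≤ θ` is definable in `(ℕ, +, ·, <)` by a first-order formula without parameters. -/
def ArithmeticallyDefinable (θ : ℝ) : Prop :=
  (∅ : Set ℕ).Definable₂ arith {x : ℕ × ℕ | 0 < x.1 ∧ 0 < x.2 ∧ (x.1 : ℝ) / (x.2 : ℝ) ≤ θ}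

/-! ### The structure of discrete random variables with independence -/

/-- The positive integers carry the discrete `σ`-algebra. -/
instance : MeasurableSpace ℕ+ := ⊤

/-- A discrete random variable: a function `[0, 1] → ℕ+` that is measurable with respect to the
`σ`-algebra of Lebesgue measurable subsets of `[0, 1]`. -/
def RandVar : Type := {X : unitInterval → ℕ+ // NullMeasurable X (volume : Measure unitInterval)}

/-- The only relation symbol of the language of probabilistic independence. -/
inductive IndepRel : ℕ → Type
  | indep : IndepRel 2

/-- The first-order language with a single binary relation symbol, for independence. -/
def language : Language := ⟨fun _ => Empty, IndepRel⟩

/-- The structure `(𝓜, ⫫)` of all discrete random variables on `[0, 1]` with Lebesgue measure,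
where `⫫` is probabilistic independence. -/
instance randVarStructure : language.Structure RandVar where
  funMap f _ := f.elim
  RelMap
    | .indep, v => IndepFun (v 0).1 (v 1).1 (volume : Measure unitInterval)

/-- The formula does not contain the equality symbol. (Mathlib's first-order formulas may contain
it, while independence is the only atomic formula of FOTPI.) -/
def EqualityFree {L : Language} {α : Type*} : ∀ {n : ℕ}, L.BoundedFormula α n → Prop
  | _, .falsum => True
  | _, .equal _ _ => False
  | _, .rel _ _ => True
  | _, .imp φ ψ => EqualityFree φ ∧ EqualityFree ψ
  | _, .all φ => EqualityFree φ

/-! ### Definability of distributions -/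

/-- The support of `X`: the set of values that `X` takes with positive probability. -/
def RandVar.support (X : RandVar) : Set ℕ+ := {k | volume {ω : unitInterval | X.1 ω = k} ≠ 0}

/-- `X` follows the probability mass function `p` up to relabelling: there is a function `f`,
injective on the support of `X`, such that `f(X)` has probability mass function `p`. -/
def FollowsUpToRelabelling {α : Type*} (X : RandVar) (p : PMF α) : Prop :=
  ∃ f : ℕ+ → α, Set.InjOn f X.support ∧ ∀ a, volume {ω : unitInterval | f (X.1 ω) = a} = p a

/-- A probability mass function `p` is definable in FOTPI if some first-order formula `P(X)`, whose
atomic formulas are independence statements only, holds if and only if `X` follows `p` up to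
relabelling. -/
def DefinablePMF {α : Type*} (p : PMF α) : Prop :=
  ∃ P : language.Formula (Fin 1), EqualityFree P ∧
    ∀ X : RandVar, P.Realize (fun _ => X) ↔ FollowsUpToRelabelling X p

/-- The probability mass function of `Bern(θ)`: value `1` with probability `θ` and value `0` with
probability `1 - θ`. -/
def bernPMF (θ : unitInterval) : PMF ℕ := (bernoulliMeasure (1 : ℕ) 0 θ).toPMF

/-- A real `θ ∈ [0, 1/2]` is Bernoulli-definable in FOTPI if the probability mass function of
`Bern(θ)` is definable in FOTPI. -/
def BernoulliDefinable (θ : Set.Icc (0 : ℝ) (1 / 2)) : Prop :=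
  DefinablePMF (bernPMF ⟨θ, θ.2.1, θ.2.2.trans (by norm_num)⟩)

end FOTPI

end

noncomputable section
set_option linter.unusedSectionVars false

namespace FOTPI

open MeasureTheory ProbabilityTheory FirstOrder FirstOrder.Language

/-! ### Relations definable without equality -/

section Definability

variable {L : Language} {M : Type*} [L.Structure M] {α β : Type}

/-! Independence alone is expressive enough to interpret arithmetic and to compare probabilities
with fractions.

Functional dependence comes first: `X` is a.s. a function of `Y` iff everything independent of `Y`
is independent of `X` (`det_iff_forall_ind`). Three pairwise independent variables, each a function
of the other two, are necessarily uniform on equally many values (`Triple.exists_isUnif`), and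
addition modulo `n` yields such triples for every `n`. Uniform variables thus serve as natural
numbers, with `n` represented by `n + 1` values. A one-time pad defines the order (`cardLe_iff`),
independent pairs define the product (`mulSize_iff`), and Robinson's identity turns order and
product into addition. By induction on formulas every arithmetical relation becomes a definable
relation between uniform variables (`NatDfn.formula`).

The link with real numbers is `ProbLe`: a uniform variable on `b` values can be recovered from `X`
and a variable with at most `r` values. This forces every atom of `X` to have mass at most `r / b`,
and for two-valued `X` the converse holds (`TwoValued.probLe_iff`). If `X` has masses `p ≤ 1/2` and
`1 - p`, the condition reads `1 - p ≤ r / b`, that is `(b - r) / b ≤ p`; hence independence sees the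
cut of `p` among the fractions in `(0, 1)`. Requiring this cut to agree with the arithmetically
defined cut of `θ` pins down `p = θ` (`twoValued_dfn`). The degenerate case `θ = 0` is `X` being
independent of itself.

All couplings come from one source: Lebesgue measure has no atoms, so any finite conditional
distribution given `X` is realized on the same space (`exists_kernel`). -/

theorem EqualityFree.castLE {m n : ℕ} (φ : L.BoundedFormula α m) (h : m ≤ n)
    (hφ : EqualityFree φ) : EqualityFree (φ.castLE h) := by
  induction φ generalizing n with
  | falsum => trivial
  | equal => exact hφ
  | rel => trivial
  | imp _ _ ih₁ ih₂ => exact ⟨ih₁ h hφ.1, ih₂ h hφ.2⟩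
  | all _ ih => exact ih _ hφ

theorem EqualityFree.relabel {m k : ℕ} (g : α → β ⊕ (Fin m)) (φ : L.BoundedFormula α k)
    (hφ : EqualityFree φ) : EqualityFree (φ.relabel g) := by
  induction φ with
  | falsum => trivial
  | equal => exact hφ
  | rel => trivial
  | imp _ _ ih₁ ih₂ => exact ⟨ih₁ hφ.1, ih₂ hφ.2⟩
  | all _ ih => exact EqualityFree.castLE _ _ (ih hφ)

/-- A relation between random variables, indexed by `α`, that is defined by a formula whose only
atomic formulas are independence statements. -/
def Dfn (R : (α → RandVar) → Prop) : Prop :=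
  ∃ φ : language.Formula α, EqualityFree φ ∧ ∀ v, φ.Realize v ↔ R v

namespace Dfn

variable {R S : (α → RandVar) → Prop}

theorem congr (hR : Dfn R) (h : ∀ v, R v ↔ S v) : Dfn S := by
  obtain ⟨φ, hφ, hr⟩ := hR
  exact ⟨φ, hφ, fun v => (hr v).trans (h v)⟩

theorem comp {R : (α → RandVar) → Prop} (hR : Dfn R) (g : α → β) :
    Dfn (fun v : β → RandVar => R (fun a => v (g a))) := by
  obtain ⟨φ, hφ, hr⟩ := hR
  exact ⟨φ.relabel g, EqualityFree.relabel _ _ hφ, fun v => Formula.realize_relabel.trans (hr _)⟩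

theorem false : Dfn (fun _ : α → RandVar => False) :=
  ⟨⊥, trivial, fun _ => Iff.rfl⟩

theorem imp (hR : Dfn R) (hS : Dfn S) : Dfn (fun v => R v → S v) := by
  obtain ⟨φ, hφ, hr⟩ := hR
  obtain ⟨ψ, hψ, hs⟩ := hS
  exact ⟨BoundedFormula.imp φ ψ, ⟨hφ, hψ⟩,
    fun v => Formula.realize_imp.trans (imp_congr (hr v) (hs v))⟩

theorem not (hR : Dfn R) : Dfn (fun v => ¬ R v) := hR.imp false

theorem and (hR : Dfn R) (hS : Dfn S) : Dfn (fun v => R v ∧ S v) :=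
  (hR.imp hS.not).not.congr fun v => by tauto

theorem iff (hR : Dfn R) (hS : Dfn S) : Dfn (fun v => R v ↔ S v) :=
  ((hR.imp hS).and (hS.imp hR)).congr fun v => by tauto

/-- The valuation on `Option α` that extends `v` by `x`. -/
def _root_.FOTPI.extend {N : Type*} (v : α → N) (x : N) (o : Option α) : N := o.elim x v

theorem all {R : (α → RandVar) → RandVar → Prop}
    (hR : Dfn (fun w : Option α → RandVar => R (fun a => w (some a)) (w none))) :
    Dfn (fun v => ∀ x, R v x) := by
  obtain ⟨φ, hφ, hr⟩ := hR
  let g : Option α → α ⊕ Fin 1 := fun o => o.elim (Sum.inr 0) Sum.inl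
  refine ⟨(BoundedFormula.relabel (n := 1) g φ).all, EqualityFree.relabel g φ hφ, fun v => ?_⟩
  refine BoundedFormula.realize_all.trans (forall_congr' fun x => ?_)
  rw [BoundedFormula.realize_relabel]
  have := hr (FOTPI.extend v x)
  refine Iff.trans (iff_of_eq ?_) this
  unfold Formula.Realize
  congr 1
  · funext o
    cases o <;> rfl
  · exact Subsingleton.elim _ _

theorem ex {R : (α → RandVar) → RandVar → Prop}
    (hR : Dfn (fun w : Option α → RandVar => R (fun a => w (some a)) (w none))) :
    Dfn (fun v => ∃ x, R v x) :=
  (all (R := fun v x => ¬ R v x) hR.not).not.congr fun v => by simp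

theorem indep (i j : α) :
    Dfn (fun v => IndepFun (v i).1 (v j).1 (volume : Measure unitInterval)) := by
  refine ⟨Relations.formula (L := language) (n := 2) IndepRel.indep
    ![Term.var i, Term.var j], trivial, fun v => ?_⟩
  exact Formula.realize_rel.trans Iff.rfl

end Dfn

end Definability

/-! ### Discrete random variables on the unit interval -/

/-- The probability of an event. -/
abbrev pr (s : Set unitInterval) : ℝ := (volume : Measure unitInterval).real s

/-- `X` is a function of `Y` almost surely. -/
def Det {α β : Type*} (X : unitInterval → α) (Y : unitInterval → β) : Prop :=
  ∃ f : β → α, ∀ᵐ ω, X ω = f (Y ω)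

/-- Null measurability with respect to Lebesgue measure. -/
abbrev NM {α : Type*} [MeasurableSpace α] (X : unitInterval → α) : Prop :=
  NullMeasurable X (volume : Measure unitInterval)

/-- Independence with respect to Lebesgue measure. -/
abbrev Ind {α β : Type*} [MeasurableSpace α] [MeasurableSpace β] (X : unitInterval → α)
    (Y : unitInterval → β) : Prop :=
  IndepFun X Y (volume : Measure unitInterval)

instance : DiscreteMeasurableSpace ℕ+ := ⟨fun _ => trivial⟩

section Basics

variable {α β γ : Type*} [MeasurableSpace α] [MeasurableSpace β] [MeasurableSpace γ]
  [DiscreteMeasurableSpace α] [DiscreteMeasurableSpace β] [DiscreteMeasurableSpace γ]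
  {X : unitInterval → α} {Y : unitInterval → β} {Z : unitInterval → γ}

theorem NM.fiber (hX : NM X) (s : Set α) :
    NullMeasurableSet {ω | X ω ∈ s} (volume : Measure unitInterval) :=
  hX (MeasurableSet.of_discrete (s := s))

theorem NM.eq_fiber (hX : NM X) (x : α) :
    NullMeasurableSet {ω | X ω = x} (volume : Measure unitInterval) :=
  hX.fiber {x}

theorem NM.map (hX : NM X) (f : α → β) : NM (fun ω => f (X ω)) :=
  fun s _ => hX.fiber (f ⁻¹' s)

theorem nm_of_fiber [Countable α] (h : ∀ x,
    NullMeasurableSet {ω | X ω = x} (volume : Measure unitInterval)) : NM X := by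
  intro s _
  have : X ⁻¹' s = ⋃ x ∈ s, {ω | X ω = x} := by ext; simp
  rw [this]
  exact NullMeasurableSet.biUnion (Set.to_countable s) fun x _ => h x

theorem NM.prodMk [Countable α] [Countable β] (hX : NM X) (hY : NM Y) :
    NM (fun ω => (X ω, Y ω)) := by
  refine nm_of_fiber fun p => ?_
  convert (hX.eq_fiber p.1).inter (hY.eq_fiber p.2) using 1
  ext ω
  simp [Prod.ext_iff]

theorem hasSum_pr [Countable β] (hY : NM Y) {s : Set unitInterval}
    (hs : NullMeasurableSet s (volume : Measure unitInterval)) :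
    HasSum (fun y => pr {ω | ω ∈ s ∧ Y ω = y}) (pr s) := by
  have hu : s = ⋃ y, {ω | ω ∈ s ∧ Y ω = y} := by ext; simp
  have hm := measure_iUnion₀ (μ := (volume : Measure unitInterval))
    (f := fun y => {ω | ω ∈ s ∧ Y ω = y})
    (fun y z hyz => Disjoint.aedisjoint (Set.disjoint_left.2 fun ω h h' =>
      hyz (h.2.symm.trans h'.2))) (fun y => hs.inter (hY.eq_fiber y))
  rw [← hu] at hm
  unfold pr Measure.real
  rw [hm, ENNReal.tsum_toReal_eq fun y => measure_ne_top _ _]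
  exact ENNReal.hasSum_toReal (hm ▸ measure_ne_top _ _)

theorem hasSum_pr_univ [Countable β] (hY : NM Y) : HasSum (fun y => pr {ω | Y ω = y}) 1 := by
  have := hasSum_pr hY (s := Set.univ) MeasurableSet.univ.nullMeasurableSet
  simpa [pr] using this

theorem hasSum_pr_and [Countable β] (hX : NM X) (hY : NM Y) (x : α) :
    HasSum (fun y => pr {ω | X ω = x ∧ Y ω = y}) (pr {ω | X ω = x}) :=
  hasSum_pr hY (hX.eq_fiber x)

theorem ind_iff [Countable α] [Countable β] (hX : NM X) (hY : NM Y) :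
    Ind X Y ↔ ∀ x y, pr {ω | X ω = x ∧ Y ω = y} = pr {ω | X ω = x} * pr {ω | Y ω = y} := by
  have hXa : AEMeasurable X := NullMeasurable.aemeasurable hX
  have hYa : AEMeasurable Y := NullMeasurable.aemeasurable hY
  constructor
  · intro h x y
    have := h.measure_inter_preimage_eq_mul _ _ (MeasurableSet.of_discrete (s := {x}))
      (MeasurableSet.of_discrete (s := {y}))
    have := congrArg ENNReal.toReal this
    rwa [ENNReal.toReal_mul] at this
  · intro h
    rw [Ind, indepFun_iff_map_prod_eq_prod_map_map hXa hYa]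
    refine Measure.ext_of_singleton fun p => ?_
    rw [Measure.map_apply_of_aemeasurable (hXa.prodMk hYa) (MeasurableSet.of_discrete),
      ← Set.singleton_prod_singleton, Measure.prod_prod,
      Measure.map_apply_of_aemeasurable hXa (MeasurableSet.of_discrete),
      Measure.map_apply_of_aemeasurable hYa (MeasurableSet.of_discrete)]
    have := h p.1 p.2
    unfold pr Measure.real at this
    rw [← ENNReal.toReal_mul, ENNReal.toReal_eq_toReal_iff' (measure_ne_top _ _)
      (ENNReal.mul_ne_top (measure_ne_top _ _) (measure_ne_top _ _))] at this
    exact this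

theorem pr_eq_of_forall_mul [Countable α] [Countable β] (hX : NM X) (hY : NM Y) {q : β → ℝ}
    (h : ∀ x y, pr {ω | X ω = x ∧ Y ω = y} = pr {ω | X ω = x} * q y) (y : β) :
    pr {ω | Y ω = y} = q y := by
  have h1 := hasSum_pr_and hY hX y
  have h2 := (hasSum_pr_univ hX).mul_right (q y)
  rw [one_mul] at h2
  refine h1.unique (h2.congr_fun fun x => ?_)
  rw [← h x y]
  simp only [and_comm]

theorem ind_of_forall_mul [Countable α] [Countable β] (hX : NM X) (hY : NM Y) {q : β → ℝ}
    (h : ∀ x y, pr {ω | X ω = x ∧ Y ω = y} = pr {ω | X ω = x} * q y) : Ind X Y :=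
  (ind_iff hX hY).2 fun x y => by rw [h, pr_eq_of_forall_mul hX hY h]

omit [MeasurableSpace α] [DiscreteMeasurableSpace α] in
theorem ae_of_pr_eq_zero [Countable α] {P : α → unitInterval → Prop}
    (h : ∀ x, pr {ω | P x ω} = 0) : ∀ᵐ ω, ∀ x, ¬ P x ω := by
  rw [ae_all_iff]
  intro x
  rw [ae_iff]
  simpa [measureReal_eq_zero_iff] using h x

theorem ae_pr_ne_zero [Countable α] : ∀ᵐ ω, pr {ω' | X ω' = X ω} ≠ 0 := by
  filter_upwards [ae_of_pr_eq_zero (P := fun (x : {x // pr {ω | X ω = x} = 0}) ω => X ω = x)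
    fun x => x.2] with ω h h0
  exact h ⟨_, h0⟩ rfl

theorem det_of_forall [Countable α] [Countable β]
    (h : ∀ y x x', pr {ω | X ω = x ∧ Y ω = y} ≠ 0 → pr {ω | X ω = x' ∧ Y ω = y} ≠ 0 → x = x') :
    Det X Y := by
  classical
  -- Values of `Y` that have positive joint mass with no `x` occur with probability zero, so the
  -- default `X 0` is harmless.
  refine ⟨fun y => if h : ∃ x, pr {ω | X ω = x ∧ Y ω = y} ≠ 0 then h.choose else X 0, ?_⟩
  filter_upwards [ae_of_pr_eq_zero (P := fun (p : {p : α × β // pr {ω | X ω = p.1 ∧ Y ω = p.2} = 0})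
    ω => X ω = p.1.1 ∧ Y ω = p.1.2) fun p => p.2] with ω hω
  have h0 : pr {ω' | X ω' = X ω ∧ Y ω' = Y ω} ≠ 0 := fun h0 => hω ⟨(X ω, Y ω), h0⟩ ⟨rfl, rfl⟩
  have hex : ∃ x, pr {ω' | X ω' = x ∧ Y ω' = Y ω} ≠ 0 := ⟨_, h0⟩
  rw [dif_pos hex]
  exact h _ _ _ h0 hex.choose_spec

theorem pr_congr {P Q : unitInterval → Prop} (h : ∀ᵐ ω, P ω ↔ Q ω) :
    pr {ω | P ω} = pr {ω | Q ω} :=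
  measureReal_congr (by filter_upwards [h] with ω hω using propext hω)

theorem pr_mono {P Q : unitInterval → Prop} (h : ∀ᵐ ω, P ω → Q ω) :
    pr {ω | P ω} ≤ pr {ω | Q ω} :=
  ENNReal.toReal_mono (measure_ne_top _ _) (measure_mono_ae h)

end Basics

/-! ### Realization of conditional distributions -/

section Realization

theorem pr_inter_Iic_sub_le (A : Set unitInterval)
    (t t' : unitInterval) (h : t ≤ t') :
    pr (A ∩ Set.Iic t') - pr (A ∩ Set.Iic t) ≤ t' - t := by
  have h1 : pr (A ∩ Set.Iic t') ≤ pr (A ∩ Set.Iic t) + pr (Set.Ioc t t') := by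
    refine (measureReal_mono (fun ω hω => ?_)).trans (measureReal_union_le _ _)
    by_cases hc : ω ≤ t
    · exact Or.inl ⟨hω.1, hc⟩
    · exact Or.inr ⟨not_le.1 hc, hω.2⟩
  have h2 : pr (Set.Ioc t t') = t' - t := by
    rw [pr, Measure.real, unitInterval.volume_Ioc, ENNReal.toReal_ofReal (sub_nonneg.2 h)]
  linarith

theorem continuous_pr_inter_Iic (A : Set unitInterval) :
    Continuous (fun t : unitInterval => pr (A ∩ Set.Iic t)) := by
  have : LipschitzWith 1 (fun t : unitInterval => pr (A ∩ Set.Iic t)) := by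
    refine LipschitzWith.of_le_add fun t t' => ?_
    rcases le_total t t' with h | h
    · have : pr (A ∩ Set.Iic t) ≤ pr (A ∩ Set.Iic t') :=
        measureReal_mono (Set.inter_subset_inter_right _ (Set.Iic_subset_Iic.2 h))
      linarith [dist_nonneg (x := t) (y := t')]
    · have := pr_inter_Iic_sub_le A t' t h
      have h3 : (t : ℝ) - t' ≤ dist t t' := by
        rw [Subtype.dist_eq, Real.dist_eq]; exact le_abs_self _
      linarith
  exact this.continuous

/-- The mass of an initial segment of `A` depends continuously on its endpoint, so the value `s` is
attained, and the segments of mass at most `s` are those up to a greatest endpoint. -/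
theorem pr_inter_pr_le (A : Set unitInterval) {s : ℝ} (h0 : 0 ≤ s) (h1 : s ≤ pr A) :
    pr (A ∩ {t | pr (A ∩ Set.Iic t) ≤ s}) = s := by
  have hc := continuous_pr_inter_Iic A
  have hg0 : pr (A ∩ Set.Iic 0) = 0 := by
    have : pr (A ∩ Set.Iic 0) ≤ pr {(0 : unitInterval)} :=
      measureReal_mono (fun ω hω => le_antisymm hω.2 ω.2.1)
    have h' : pr {(0 : unitInterval)} = 0 := by simp [pr, Measure.real]
    exact le_antisymm (h' ▸ this) measureReal_nonneg
  have hg1 : pr (A ∩ Set.Iic 1) = pr A := by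
    congr 1
    exact Set.inter_eq_left.2 fun ω _ => ω.2.2
  obtain ⟨t₀, ht₀⟩ : ∃ t₀, pr (A ∩ Set.Iic t₀) = s := by
    have := intermediate_value_univ (0 : unitInterval) 1 hc
    exact this ⟨hg0 ▸ h0, hg1 ▸ h1⟩
  obtain ⟨t₁, h₁, hmax⟩ := (isClosed_le hc continuous_const : IsClosed
    {t | pr (A ∩ Set.Iic t) ≤ s}).isCompact.exists_isGreatest ⟨t₀, ht₀.le⟩
  have heq : {t | pr (A ∩ Set.Iic t) ≤ s} = Set.Iic t₁ := by
    ext t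
    refine ⟨fun h => hmax h, fun h => ?_⟩
    exact (measureReal_mono (Set.inter_subset_inter_right _ (Set.Iic_subset_Iic.2 h))).trans h₁
  rw [heq]
  refine le_antisymm h₁ ?_
  rw [← ht₀]
  exact measureReal_mono (Set.inter_subset_inter_right _ (Set.Iic_subset_Iic.2 (hmax ht₀.le)))

variable {α : Type*} [MeasurableSpace α] [DiscreteMeasurableSpace α] [Countable α]
  {X : unitInterval → α}

/-- Inverse transform sampling inside each fiber: `U ω` is the mass of the part of the fiber of `X`
through `ω` lying to the left of `ω`, and `Y ω` is the index of the interval between consecutive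
cumulative weights `c` into which it falls. -/
theorem exists_nat_kernel (hX : NM X) (w : α → ℕ → ℝ) (h0 : ∀ x n, 0 ≤ w x n) (m : ℕ)
    (hm : 0 < m) (h1 : ∀ x, ∑ n ∈ Finset.range m, w x n = 1) :
    ∃ Y : unitInterval → ℕ, NM Y ∧ (∀ ω, Y ω < m) ∧ ∀ x, ∀ n < m,
      pr {ω | X ω = x ∧ Y ω = n} = pr {ω | X ω = x} * w x n := by
  classical
  let U : unitInterval → ℝ := fun ω => pr ({ω' | X ω' = X ω} ∩ Set.Iic ω)
  let c : α → ℕ → ℝ := fun x n => pr {ω | X ω = x} * ∑ i ∈ Finset.range n, w x i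
  have hcmono : ∀ x, Monotone (c x) := fun x i j hij =>
    mul_le_mul_of_nonneg_left (Finset.sum_le_sum_of_subset_of_nonneg
      (Finset.range_mono hij) fun n _ _ => h0 x n) measureReal_nonneg
  have hcm : ∀ x, c x m = pr {ω | X ω = x} := fun x => by simp [c, h1]
  have hex : ∀ ω, ∃ n, U ω ≤ c (X ω) (n + 1) := fun ω =>
    ⟨m - 1, (measureReal_mono Set.inter_subset_left).trans
      ((hcm (X ω)).symm.le.trans_eq (by rw [Nat.sub_add_cancel hm]))⟩
  let Y : unitInterval → ℕ := fun ω => Nat.find (hex ω)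
  have hY : ∀ x n, {ω | X ω = x ∧ Y ω < n} = {ω | X ω = x} ∩
      {t | pr ({ω | X ω = x} ∩ Set.Iic t) ≤ c x n ∧ 0 < n} := by
    intro x n
    ext ω
    constructor
    · rintro ⟨rfl, h⟩
      refine ⟨rfl, ?_, by omega⟩
      exact (Nat.find_spec (hex ω)).trans (hcmono _ h)
    · rintro ⟨rfl, h, hn⟩
      refine ⟨rfl, ?_⟩
      obtain ⟨k, rfl⟩ : ∃ k, n = k + 1 := ⟨n - 1, by omega⟩
      exact Nat.lt_succ_of_le (Nat.find_min' (hex ω) h)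
  have hYm : ∀ x n, NullMeasurableSet {ω | X ω = x ∧ Y ω < n} := by
    intro x n
    rw [hY]
    refine (hX.eq_fiber x).inter (MeasurableSet.nullMeasurableSet ?_)
    exact (isClosed_le (continuous_pr_inter_Iic _) continuous_const).measurableSet.inter
      (MeasurableSet.const _)
  have hYp : ∀ x, ∀ n ≤ m, pr {ω | X ω = x ∧ Y ω < n} = c x n := by
    intro x n hn
    rcases Nat.eq_zero_or_pos n with rfl | hpos
    · simp [c]
    · rw [hY]
      simp only [hpos, and_true]
      refine pr_inter_pr_le _ (mul_nonneg measureReal_nonneg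
        (Finset.sum_nonneg fun i _ => h0 x i)) ?_
      exact (hcmono x hn).trans (hcm x).le
  have hdiff : ∀ x n, {ω | X ω = x ∧ Y ω = n} =
      {ω | X ω = x ∧ Y ω < n + 1} \ {ω | X ω = x ∧ Y ω < n} := by
    intro x n
    ext ω
    simp only [Set.mem_ofPred_eq, Set.mem_sdiff]
    constructor
    · rintro ⟨rfl, rfl⟩
      exact ⟨⟨rfl, by omega⟩, fun h => by omega⟩
    · rintro ⟨⟨rfl, h⟩, h'⟩
      exact ⟨rfl, le_antisymm (Nat.lt_succ_iff.1 h) (not_lt.1 fun h'' => h' ⟨rfl, h''⟩)⟩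
  refine ⟨Y, nm_of_fiber fun n => ?_, fun ω => ?_, fun x n hn => ?_⟩
  · have : {ω | Y ω = n} = ⋃ x, {ω | X ω = x ∧ Y ω = n} := by ext; simp
    rw [this]
    refine NullMeasurableSet.iUnion fun x => ?_
    rw [hdiff]
    exact (hYm x _).diff (hYm x _)
  · refine (Nat.find_min' (hex ω) (m := m - 1) ?_).trans_lt (by omega)
    rw [Nat.sub_add_cancel hm, hcm]
    exact measureReal_mono Set.inter_subset_left
  · have hsub : {ω | X ω = x ∧ Y ω < n} ⊆ {ω | X ω = x ∧ Y ω < n + 1} :=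
      fun ω h => ⟨h.1, h.2.trans (Nat.lt_succ_self n)⟩
    have h1 := hYp x n hn.le
    have h2 := hYp x (n + 1) hn
    rw [hdiff, pr, Measure.real, measure_sdiff hsub (hYm x n) (measure_ne_top _ _),
      ENNReal.toReal_sub_of_le (measure_mono hsub) (measure_ne_top _ _)]
    unfold pr Measure.real at h1 h2
    rw [h1, h2]
    simp only [c, Finset.sum_range_succ]
    ring

/-- Every finite conditional distribution given `X` is realized by a random variable. -/
theorem exists_kernel (hX : NM X) {β : Type*} [Fintype β] [MeasurableSpace β]
    [DiscreteMeasurableSpace β] [Nonempty β] (w : α → β → ℝ)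
    (h0 : ∀ x b, 0 ≤ w x b) (h1 : ∀ x, pr {ω | X ω = x} ≠ 0 → ∑ b, w x b = 1) :
    ∃ Y : unitInterval → β, NM Y ∧
      ∀ x b, pr {ω | X ω = x ∧ Y ω = b} = pr {ω | X ω = x} * w x b := by
  classical
  let e := Fintype.equivFin β
  have hcard : 0 < Fintype.card β := Fintype.card_pos
  -- On null values of `X` the weights need not sum to `1`; a point mass at `0` replaces them there.
  let w' : α → ℕ → ℝ := fun x n =>
    if pr {ω | X ω = x} = 0 then (if n = 0 then 1 else 0)
    else if h : n < Fintype.card β then w x (e.symm ⟨n, h⟩) else 0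
  obtain ⟨Y, hY, hlt, hp⟩ := exists_nat_kernel hX w' (fun x n => by
      simp only [w']
      split_ifs <;> simp [h0]) (Fintype.card β) hcard (fun x => by
      by_cases hx : pr {ω | X ω = x} = 0
      · simp [w', hx, Finset.sum_ite_eq', hcard]
      · rw [← h1 x hx, ← Fin.sum_univ_eq_sum_range, ← e.symm.sum_comp]
        simp [w', hx])
  have heq : ∀ ω b, e.symm ⟨Y ω, hlt ω⟩ = b ↔ Y ω = e b := fun ω b => by
    rw [Equiv.symm_apply_eq, Fin.ext_iff]
  refine ⟨fun ω => e.symm ⟨Y ω, hlt ω⟩, nm_of_fiber fun b => ?_, fun x b => ?_⟩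
  · simp only [heq]
    exact hY.eq_fiber _
  · simp only [heq]
    rw [hp x _ (e b).2]
    by_cases hx : pr {ω | X ω = x} = 0
    · simp [hx]
    · simp [w', hx]

end Realization

/-! ### Almost sure functional dependence and its interplay with independence -/

section Det

variable {α β γ δ : Type*} {X : unitInterval → α} {Y : unitInterval → β} {Z : unitInterval → γ}

theorem Det.of_fun (f : β → α) : Det (fun ω => f (Y ω)) Y := ⟨f, by simp⟩

theorem Det.fst : Det X (fun ω => (X ω, Y ω)) := ⟨Prod.fst, by simp⟩

theorem Det.snd : Det Y (fun ω => (X ω, Y ω)) := ⟨Prod.snd, by simp⟩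

theorem Det.trans (h : Det X Y) (h' : Det Y Z) : Det X Z := by
  obtain ⟨f, hf⟩ := h
  obtain ⟨g, hg⟩ := h'
  exact ⟨f ∘ g, by filter_upwards [hf, hg] with ω h1 h2 using by rw [h1, h2]; rfl⟩

theorem Det.prodMk (h : Det X Z) (h' : Det Y Z) : Det (fun ω => (X ω, Y ω)) Z := by
  obtain ⟨f, hf⟩ := h
  obtain ⟨g, hg⟩ := h'
  exact ⟨fun z => (f z, g z), by filter_upwards [hf, hg] with ω h1 h2 using by rw [h1, h2]⟩

theorem Det.prod_left (h : Det X Y) : Det X (fun ω => (Y ω, Z ω)) := h.trans .fst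

theorem Det.prod_right (h : Det X Z) : Det X (fun ω => (Y ω, Z ω)) := h.trans .snd

end Det

section Calculus

variable {α β γ δ : Type*} [MeasurableSpace α] [MeasurableSpace β] [MeasurableSpace γ]
  [MeasurableSpace δ] [DiscreteMeasurableSpace α] [DiscreteMeasurableSpace β]
  [DiscreteMeasurableSpace γ] [DiscreteMeasurableSpace δ]
  {X : unitInterval → α} {Y : unitInterval → β} {Z : unitInterval → γ} {W : unitInterval → δ}

theorem Ind.symm (h : Ind X Y) : Ind Y X := IndepFun.symm h

theorem Ind.det_left (h : Ind X Y) (h' : Det Z X) : Ind Z Y := by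
  obtain ⟨f, hf⟩ := h'
  exact (IndepFun.comp h (.of_discrete (f := f)) measurable_id).congr (by
    filter_upwards [hf] with ω h1 using h1.symm) (by rfl)

theorem Ind.det (h : Ind X Y) (h1 : Det Z X) (h2 : Det W Y) : Ind Z W :=
  Ind.symm (Ind.det_left (Ind.symm (h.det_left h1)) h2)

variable [Countable α] [Countable β] [Countable γ]

/-- An arbitrary injection of a countable type into the positive integers. -/
def code (α : Type*) [Countable α] (a : α) : ℕ+ :=
  Nat.succPNat ((Countable.exists_injective_nat α).choose a)

theorem code_injective (α : Type*) [Countable α] : Function.Injective (code α) :=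
  Nat.succPNat_injective.comp (Countable.exists_injective_nat α).choose_spec

/-- A random variable with values in a countable type, as an element of the structure. -/
def RandVar.of (X : unitInterval → α) (hX : NM X) : RandVar := ⟨fun ω => code α (X ω), hX.map _⟩

theorem RandVar.nm (X : RandVar) : NM X.1 := X.2

theorem of_det (hX : NM X) : Det (RandVar.of X hX).1 X := .of_fun (code α)

theorem det_of (hX : NM X) : Det X (RandVar.of X hX).1 := by
  have : Nonempty α := ⟨X 0⟩
  exact ⟨Function.invFun (code α), .of_forall fun ω =>
    (Function.leftInverse_invFun (code_injective α) (X ω)).symm⟩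

theorem exists_pr_ne_zero (hX : NM X) : ∃ x, pr {ω | X ω = x} ≠ 0 := by
  by_contra! h
  have := hasSum_pr_univ hX
  simp only [h] at this
  exact zero_ne_one (hasSum_zero.unique this)

end Calculus

/-! ### Functional dependence is definable -/

/-- If `X` is not a function of `Y`, some `y₀` occurs with two values `x₀`, `x₁` of `X`. A fair bit
whose bias is raised at `(x₀, y₀)` and lowered at `(x₁, y₀)`, in balance, is still independent of
`Y` but is correlated with `X`. -/
theorem det_iff_forall_ind (X Y : RandVar) :
    Det X.1 Y.1 ↔ ∀ Z : RandVar, Ind Z.1 Y.1 → Ind Z.1 X.1 := by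
  classical
  refine ⟨fun h Z hZ => Ind.symm (Ind.det_left (Ind.symm hZ) h), fun h => ?_⟩
  refine det_of_forall fun y₀ x₀ x₁ hp hq => ?_
  by_contra hne
  set p := pr {ω | X.1 ω = x₀ ∧ Y.1 ω = y₀} with hp_def
  set q := pr {ω | X.1 ω = x₁ ∧ Y.1 ω = y₀} with hq_def
  have hp0 : 0 ≤ p := measureReal_nonneg
  have hq0 : 0 ≤ q := measureReal_nonneg
  have hp1 : p ≤ 1 := measureReal_le_one
  have hq1 : q ≤ 1 := measureReal_le_one
  -- The tilts `q` and `-p` are weighted by the masses `p` and `q`, so they cancel on the fiber `Y =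
  -- y₀`.
  let d : ℕ+ × ℕ+ → ℝ := fun a => if a = (x₀, y₀) then q else if a = (x₁, y₀) then -p else 0
  have hd : ∀ a, -1 ≤ d a ∧ d a ≤ 1 := fun a => by
    simp only [d]; split_ifs <;> constructor <;> linarith
  obtain ⟨B, hB, hBp⟩ := exists_kernel (X.nm.prodMk Y.nm)
    (β := Bool) (fun a b => (1 + (if b then d a else - d a)) / 2)
    (fun a b => by have := hd a; split_ifs <;> linarith)
    (fun a _ => by simp; ring)
  have hxy : ∀ x y b, pr {ω | (Y.1 ω = y ∧ B ω = b) ∧ X.1 ω = x} =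
      pr {ω | X.1 ω = x ∧ Y.1 ω = y} * ((1 + (if b then d (x, y) else - d (x, y))) / 2) := by
    intro x y b
    have := hBp (x, y) b
    simp only [Prod.mk.injEq] at this
    rw [← this]
    congr 1
    ext ω
    simp only [Set.mem_ofPred_eq]
    tauto
  have hsum : ∀ y, HasSum (fun x => pr {ω | X.1 ω = x ∧ Y.1 ω = y} * d (x, y)) 0 := by
    intro y
    have h0 : ∑ x ∈ {x₀, x₁}, pr {ω | X.1 ω = x ∧ Y.1 ω = y} * d (x, y) = 0 := by
      rw [Finset.sum_pair hne]
      by_cases hy : y = y₀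
      · subst hy
        simp only [d, if_true, Prod.mk.injEq, and_true, Ne.symm hne, if_false]
        ring
      · simp [d, hy]
    rw [← h0]
    refine hasSum_sum_of_ne_finset_zero fun x hx => ?_
    simp only [Finset.mem_insert, Finset.mem_singleton, not_or] at hx
    simp [d, hx.1, hx.2]
  have hYB : ∀ y b, pr {ω | Y.1 ω = y ∧ B ω = b} = pr {ω | Y.1 ω = y} * (1 / 2) := by
    intro y b
    have h1 := hasSum_pr X.nm ((Y.nm.eq_fiber y).inter (hB.eq_fiber b))
    have h2 := (hasSum_pr_and Y.nm X.nm y).mul_right (1 / 2)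
    have h3 := h2.add ((hsum y).mul_right (if b then 1 / 2 else - 1 / 2))
    rw [zero_mul, add_zero] at h3
    refine h1.unique (h3.congr_fun fun x => (hxy x y b).trans ?_)
    simp only [and_comm]
    cases b <;> simp <;> ring
  have hind := h (.of B hB) (Ind.det_left (Ind.symm (ind_of_forall_mul Y.nm hB hYB)) (of_det hB))
  have hind' := (ind_iff hB X.nm).1 (Ind.det_left hind (det_of hB)) true x₀
  rw [pr_eq_of_forall_mul Y.nm hB hYB] at hind'
  have h1 := hasSum_pr Y.nm ((hB.eq_fiber true).inter (X.nm.eq_fiber x₀))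
  have h2 := (hasSum_pr_and X.nm Y.nm x₀).mul_right (1 / 2)
  -- On `X = x₀` only one tilt is present; it contributes the excess `p * q / 2`, which independence
  -- of `B` and `X` forces to vanish.
  have h3 : HasSum (fun y => pr {ω | X.1 ω = x₀ ∧ Y.1 ω = y} * d (x₀, y) * (1 / 2))
      (p * q * (1 / 2)) := by
    have : p * q * (1 / 2) = pr {ω | X.1 ω = x₀ ∧ Y.1 ω = y₀} * d (x₀, y₀) * (1 / 2) := by
      simp [d, p]
    rw [this]
    refine hasSum_single _ fun y hy => ?_
    simp [d, hy]
  have h4 := h1.unique ((h2.add h3).congr_fun fun y => ?_)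
  · change pr {ω | B ω = true ∧ X.1 ω = x₀} = _ at h4
    rw [hind'] at h4
    have : p * q = 0 := by linarith
    rcases mul_eq_zero.1 this with h5 | h5
    · exact hp h5
    · exact hq h5
  · have := hxy x₀ y true
    simp only [if_true] at this
    have e : {ω | ω ∈ {ω | B ω = true} ∩ {ω | X.1 ω = x₀} ∧ Y.1 ω = y} =
        {ω | (Y.1 ω = y ∧ B ω = true) ∧ X.1 ω = x₀} := by
      ext ω
      simp only [Set.mem_inter_iff, Set.mem_ofPred_eq]
      tauto
    rw [e, this]
    ring

/-- The pair can itself be encoded as one random variable `J`, which removes the pairing from the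
language. -/
theorem det_pair_iff (X Y Z : RandVar) : Det X.1 (fun ω => (Y.1 ω, Z.1 ω)) ↔
    ∀ J : RandVar, Det Y.1 J.1 → Det Z.1 J.1 → Det X.1 J.1 := by
  refine ⟨fun h J h1 h2 => h.trans (h1.prodMk h2), fun h => ?_⟩
  have hm := Y.nm.prodMk Z.nm
  exact (h (.of _ hm) (Det.fst.trans (det_of hm))
    (Det.snd.trans (det_of hm))).trans (of_det hm)

namespace Dfn

variable {α : Type}

theorem det (i j : α) : Dfn (fun v => Det (v i).1 (v j).1) :=
  (all (R := fun v Z => Ind Z.1 (v j).1 → Ind Z.1 (v i).1)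
    ((indep none (some j)).imp (indep none (some i)))).congr fun v =>
      (det_iff_forall_ind (v i) (v j)).symm

theorem det_pair (i j k : α) : Dfn (fun v => Det (v i).1 (fun ω => ((v j).1 ω, (v k).1 ω))) :=
  (all (R := fun v J => Det (v j).1 J.1 → Det (v k).1 J.1 → Det (v i).1 J.1)
    ((det (some j) none).imp ((det (some k) none).imp (det (some i) none)))).congr fun v =>
      (det_pair_iff (v i) (v j) (v k)).symm

end Dfn

/-! ### Uniform distributions -/

/-- `A` is uniformly distributed on `Fin n`. -/
structure Unif {n : ℕ} (A : unitInterval → Fin n) : Prop where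
  nm : NM A
  pr_eq : ∀ i, pr {ω | A ω = i} = 1 / n

/-- `X` is uniformly distributed on `n` values. -/
def IsUnif (X : RandVar) (n : ℕ) : Prop :=
  ∃ A : unitInterval → Fin n, Unif A ∧ Det X.1 A ∧ Det A X.1

theorem IsUnif.pos {X : RandVar} {n : ℕ} (h : IsUnif X n) : 0 < n := by
  obtain ⟨A, -⟩ := h
  exact (A 0).pos

theorem Unif.pos {n : ℕ} {A : unitInterval → Fin n} (_ : Unif A) : 0 < n := (A 0).pos

theorem Unif.isUnif {n : ℕ} {A : unitInterval → Fin n} (h : Unif A) :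
    IsUnif (.of A h.nm) n := ⟨A, h, of_det _, det_of _⟩

/-- An atom of `Y`, of mass `1 / m`, lies a.s. inside an atom of `X`, of mass `1 / n`. -/
theorem IsUnif.le_of_det {X Y : RandVar} {n m : ℕ} (hX : IsUnif X n) (hY : IsUnif Y m)
    (h : Det X.1 Y.1) : n ≤ m := by
  obtain ⟨A, hA, -, h1⟩ := hX
  obtain ⟨B, hB, h2, -⟩ := hY
  obtain ⟨f, hf⟩ := (h1.trans h).trans h2
  have hm : (0 : ℝ) < m := by exact_mod_cast hB.pos
  have hn : (0 : ℝ) < n := by exact_mod_cast hA.pos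
  have h3 : pr {ω | B ω = B 0} ≤ pr {ω | A ω = f (B 0)} :=
    pr_mono (by filter_upwards [hf] with ω h1 h2 using by rw [h1, h2])
  rw [hA.pr_eq, hB.pr_eq, one_div_le_one_div hm hn] at h3
  exact_mod_cast h3

theorem IsUnif.unique {X : RandVar} {n m : ℕ} (hX : IsUnif X n) (hY : IsUnif X m) : n = m :=
  le_antisymm (hX.le_of_det hY (.of_fun id)) (hY.le_of_det hX (.of_fun id))

section

variable {α : Type*} [MeasurableSpace α] [DiscreteMeasurableSpace α] [Countable α]
  {X : unitInterval → α}

theorem exists_unif_indep (hX : NM X) {n : ℕ} (hn : 0 < n) :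
    ∃ C : unitInterval → Fin n, Unif C ∧ Ind X C := by
  have : Nonempty (Fin n) := ⟨⟨0, hn⟩⟩
  have hn' : (n : ℝ) ≠ 0 := by exact_mod_cast hn.ne'
  obtain ⟨C, hC, hp⟩ := exists_kernel hX (β := Fin n) (fun _ _ => 1 / n)
    (fun _ _ => by positivity) (fun _ _ => by simp [hn'])
  exact ⟨C, ⟨hC, pr_eq_of_forall_mul hX hC hp⟩, ind_of_forall_mul hX hC hp⟩

/-- The one-time pad: given `X = x`, adding `f x` merely permutes `Fin n`. -/
theorem Unif.shift {n : ℕ} [NeZero n] {C : unitInterval → Fin n} (hC : Unif C) (hX : NM X)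
    (h : Ind X C) (f : α → Fin n) :
    Unif (fun ω => f (X ω) + C ω) ∧ Ind X (fun ω => f (X ω) + C ω) := by
  have hm : NM (fun ω => f (X ω) + C ω) := (hX.prodMk hC.nm).map fun p => f p.1 + p.2
  have hp : ∀ x i, pr {ω | X ω = x ∧ f (X ω) + C ω = i} = pr {ω | X ω = x} * (1 / n) := by
    intro x i
    rw [← hC.pr_eq (i - f x), ← (ind_iff hX hC.nm).1 h]
    congr 1
    ext ω
    simp only [Set.mem_ofPred_eq]
    refine and_congr_right fun hx => ?_
    rw [hx, eq_sub_iff_add_eq, add_comm]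
  exact ⟨⟨hm, pr_eq_of_forall_mul hX hm hp⟩, ind_of_forall_mul hX hm hp⟩

end

/-- Only finitely many atoms can have the same positive mass `c`, since the masses sum to `1`. -/
theorem exists_isUnif_of_pr_eq {X : RandVar} {c : ℝ}
    (h : ∀ x, pr {ω | X.1 ω = x} ≠ 0 → pr {ω | X.1 ω = x} = c) :
    ∃ n : ℕ, n * c = 1 ∧ IsUnif X n := by
  classical
  have hs := hasSum_pr_univ X.nm
  obtain ⟨x₀, hx₀⟩ := exists_pr_ne_zero X.nm
  have hc : 0 < c := h x₀ hx₀ ▸ lt_of_le_of_ne measureReal_nonneg hx₀.symm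
  have hfin : {x | pr {ω | X.1 ω = x} ≠ 0}.Finite := by
    have := hs.summable.tendsto_cofinite_zero.eventually (gt_mem_nhds hc)
    rw [Filter.eventually_cofinite] at this
    exact this.subset fun x hx => not_lt.2 (h x hx).ge
  let S := hfin.toFinset
  have hS : ∀ x, x ∈ S ↔ pr {ω | X.1 ω = x} ≠ 0 := fun x => hfin.mem_toFinset
  have hcard : (S.card : ℝ) * c = 1 := by
    have h1 : HasSum (fun x => pr {ω | X.1 ω = x}) (∑ x ∈ S, pr {ω | X.1 ω = x}) :=
      hasSum_sum_of_ne_finset_zero fun x hx => by_contra fun h' => hx ((hS x).2 h')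
    rw [hs.unique h1, Finset.sum_congr rfl fun x hx => h x ((hS x).1 hx)]
    simp
  let e := S.equivFin
  let e₀ : Fin S.card := e ⟨x₀, (hS x₀).2 hx₀⟩
  let f : ℕ+ → Fin S.card := fun x => if hx : x ∈ S then e ⟨x, hx⟩ else e₀
  have hae : ∀ᵐ ω, X.1 ω ∈ S := by
    filter_upwards [ae_pr_ne_zero (X := X.1)] with ω hω using (hS _).2 hω
  refine ⟨S.card, hcard, fun ω => f (X.1 ω), ⟨X.nm.map f, fun i => ?_⟩,
    ⟨fun i => (e.symm i).1, ?_⟩, .of_fun f⟩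
  · have h1 : pr {ω | f (X.1 ω) = i} = pr {ω | X.1 ω = (e.symm i).1} := by
      refine pr_congr ?_
      filter_upwards [hae] with ω hω
      simp only [f, hω, dif_pos]
      rw [← Equiv.eq_symm_apply, Subtype.ext_iff]
    rw [h1, h _ ((hS _).1 (e.symm i).2), eq_div_iff (left_ne_zero_of_mul_eq_one hcard), mul_comm,
      hcard]
  · filter_upwards [hae] with ω hω
    simp [f, hω]

/-- Three pairwise independent random variables, each a function of the other two. -/
def Triple (X Y Z : RandVar) : Prop :=
  (Ind X.1 Y.1 ∧ Ind X.1 Z.1 ∧ Ind Y.1 Z.1) ∧ Det X.1 (fun ω => (Y.1 ω, Z.1 ω)) ∧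
    Det Y.1 (fun ω => (X.1 ω, Z.1 ω)) ∧ Det Z.1 (fun ω => (X.1 ω, Y.1 ω))

/-- For atoms `x`, `y` there is a `z` such that the events `(x, y)`, `(x, z)`, `(y, z)` coincide
a.s., because any two of the values determine the third. Pairwise independence gives `P(x) P(z) =
P(y) P(z)`, so all atoms of `X` and of `Y` share one mass. -/
theorem Triple.exists_isUnif {X Y Z : RandVar} (h : Triple X Y Z) :
    ∃ n, IsUnif X n ∧ IsUnif Y n := by
  obtain ⟨⟨hxy, hxz, hyz⟩, ⟨f, hf⟩, ⟨g, hg⟩, ⟨k, hk⟩⟩ := h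
  rw [ind_iff X.nm Y.nm] at hxy
  rw [ind_iff X.nm Z.nm] at hxz
  rw [ind_iff Y.nm Z.nm] at hyz
  have key : ∀ x y, pr {ω | X.1 ω = x} ≠ 0 → pr {ω | Y.1 ω = y} ≠ 0 →
      pr {ω | X.1 ω = x} = pr {ω | Y.1 ω = y} := by
    intro x y hx hy
    have hpos : pr {ω | X.1 ω = x ∧ Y.1 ω = y} ≠ 0 := by rw [hxy]; exact mul_ne_zero hx hy
    have hne : ∃ ω, (X.1 ω = x ∧ Y.1 ω = y) ∧ X.1 ω = f (Y.1 ω, Z.1 ω) ∧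
        Y.1 ω = g (X.1 ω, Z.1 ω) ∧ Z.1 ω = k (X.1 ω, Y.1 ω) := by
      by_contra! hcon
      refine hpos ?_
      rw [measureReal_eq_zero_iff, ← nonpos_iff_eq_zero]
      refine (measure_mono_ae (t := ∅) ?_).trans (by simp)
      filter_upwards [hf, hg, hk] with ω h1 h2 h3 h4
      exact hcon ω h4 h1 h2 h3
    obtain ⟨ω₀, ⟨h1, h2⟩, h3, h4, h5⟩ := hne
    set z := Z.1 ω₀ with hz
    rw [h1, h2] at h3 h4 h5
    have e1 : pr {ω | X.1 ω = x ∧ Y.1 ω = y} = pr {ω | X.1 ω = x ∧ Z.1 ω = z} := by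
      refine pr_congr ?_
      filter_upwards [hg, hk] with ω hω hω'
      refine and_congr_right fun hx => ⟨fun hy => ?_, fun hz => ?_⟩
      · rw [hω', hx, hy, h5]
      · rw [hω, hx, hz, ← h4]
    have e2 : pr {ω | X.1 ω = x ∧ Y.1 ω = y} = pr {ω | Y.1 ω = y ∧ Z.1 ω = z} := by
      refine pr_congr ?_
      filter_upwards [hf, hk] with ω hω hω'
      constructor
      · rintro ⟨hx, hy⟩
        exact ⟨hy, by rw [hω', hx, hy, h5]⟩
      · rintro ⟨hy, hz⟩
        exact ⟨by rw [hω, hy, hz, ← h3], hy⟩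
    have hz0 : pr {ω | Z.1 ω = z} ≠ 0 := by
      intro h0
      rw [e1, hxz, h0, mul_zero] at hpos
      exact hpos rfl
    rw [e1, hxz, hyz] at e2
    exact mul_right_cancel₀ hz0 e2
  obtain ⟨x, hx⟩ := exists_pr_ne_zero X.nm
  obtain ⟨n, hn, hX⟩ := exists_isUnif_of_pr_eq (X := X) (c := pr {ω | X.1 ω = x}) fun x' hx' => by
    obtain ⟨y, hy⟩ := exists_pr_ne_zero Y.nm
    rw [key x' y hx' hy, key x y hx hy]
  obtain ⟨m, hm, hY⟩ := exists_isUnif_of_pr_eq (X := Y) (c := pr {ω | X.1 ω = x})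
    fun y hy => (key x y hx hy).symm
  have : n = m := by exact_mod_cast mul_right_cancel₀ hx (hn.trans hm.symm)
  exact ⟨n, hX, this ▸ hY⟩

/-- The third member is the sum `A + C` modulo `n`. -/
theorem triple_of_unif {X : RandVar} {n : ℕ} [NeZero n] {A C : unitInterval → Fin n} (hA : Unif A)
    (hC : Unif C) (h : Ind A C) (h1 : Det X.1 A) (h2 : Det A X.1) :
    ∃ Z, Triple X (.of C hC.nm) Z := by
  have hs := hC.shift hA.nm h id
  have hs' := hA.shift hC.nm h.symm id
  simp only [id] at hs hs'
  have hcomm : (fun ω => C ω + A ω) = fun ω => A ω + C ω := by simp only [add_comm]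
  rw [hcomm] at hs'
  refine ⟨.of (fun ω => A ω + C ω) hs.1.nm,
    ⟨h.det h1 (of_det _), hs.2.det h1 (of_det _), hs'.2.det (of_det _) (of_det _)⟩, ?_, ?_, ?_⟩
  · refine h1.trans (Det.trans (Y := fun ω => (C ω, A ω + C ω))
      ⟨fun p => p.2 - p.1, by simp⟩ ((det_of hC.nm).prod_left.prodMk (det_of hs.1.nm).prod_right))
  · refine (of_det _).trans (Det.trans (Y := fun ω => (A ω, A ω + C ω))
      ⟨fun p => p.2 - p.1, by simp⟩ (h2.prod_left.prodMk (det_of hs.1.nm).prod_right))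
  · refine (of_det _).trans (Det.trans (Y := fun ω => (A ω, C ω))
      ⟨fun p => p.1 + p.2, by simp⟩ (h2.prod_left.prodMk (det_of hC.nm).prod_right))

/-- `X` and `Y` are uniform with the same number of values, in terms of independence. -/
def SameSize (X Y : RandVar) : Prop := ∃ W Z Z', Triple X W Z ∧ Triple Y W Z'

/-- The intermediary `W` is needed because `X` and `Y` may be dependent; it is chosen uniform and
independent of the pair. -/
theorem sameSize_iff {X Y : RandVar} : SameSize X Y ↔ ∃ n, IsUnif X n ∧ IsUnif Y n := by
  constructor
  · rintro ⟨W, Z, Z', h, h'⟩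
    obtain ⟨n, h1, h2⟩ := h.exists_isUnif
    obtain ⟨m, h3, h4⟩ := h'.exists_isUnif
    exact ⟨n, h1, h2.unique h4 ▸ h3⟩
  · rintro ⟨n, ⟨A, hA, hA1, hA2⟩, ⟨B, hB, hB1, hB2⟩⟩
    have : NeZero n := ⟨hA.pos.ne'⟩
    obtain ⟨C, hC, hi⟩ := exists_unif_indep (hA.nm.prodMk hB.nm) hA.pos
    obtain ⟨Z, hZ⟩ := triple_of_unif hA hC (Ind.det_left hi .fst) hA1 hA2
    obtain ⟨Z', hZ'⟩ := triple_of_unif hB hC (Ind.det_left hi .snd) hB1 hB2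
    exact ⟨_, Z, Z', hZ, hZ'⟩

theorem sameSize_self_iff {X : RandVar} : SameSize X X ↔ ∃ n, IsUnif X n := by
  simp [sameSize_iff]

/-- `X` takes at most `n` values. -/
def AtMost (X : RandVar) (n : ℕ) : Prop := ∃ S : Finset ℕ+, S.card ≤ n ∧ ∀ᵐ ω, X.1 ω ∈ S

/-- `R` takes at most as many values as the uniform random variable `D`, in terms of
independence. -/
def CardLe (R D : RandVar) : Prop :=
  ∃ U Z : RandVar, SameSize D U ∧ Ind Z.1 R.1 ∧ Det R.1 (fun ω => (U.1 ω, Z.1 ω))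

/-- Given a fixed value `z` of `Z`, at most `n` values of `R` are possible, and by independence
every atom of `R` still occurs. Conversely `Z` is a uniform key and `U` is the encryption of `R`
with it. -/
theorem cardLe_iff {R D : RandVar} {n : ℕ} (hD : IsUnif D n) : CardLe R D ↔ AtMost R n := by
  classical
  constructor
  · rintro ⟨U, Z, hU, hi, hd⟩
    obtain ⟨m, h1, A, hA, hA1, -⟩ := sameSize_iff.1 hU
    obtain rfl := hD.unique h1
    obtain ⟨z, hz⟩ := exists_pr_ne_zero Z.nm
    obtain ⟨f, hf⟩ := hd.trans ((hA1.prod_left (Z := Z.1)).prodMk Det.snd)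
    refine ⟨Finset.univ.image fun a => f (a, z), Finset.card_image_le.trans (by simp), ?_⟩
    filter_upwards [ae_pr_ne_zero (X := R.1)] with ω hω
    by_contra hcon
    simp only [Finset.mem_image, Finset.mem_univ, true_and, not_exists] at hcon
    have h0 : pr {ω' | Z.1 ω' = z ∧ R.1 ω' = R.1 ω} = 0 := by
      rw [measureReal_eq_zero_iff, ← nonpos_iff_eq_zero]
      refine (measure_mono_ae (t := ∅) ?_).trans (by simp)
      filter_upwards [hf] with ω' h1 h2
      refine hcon (A ω') ?_
      rw [← h2.2, ← h2.1, h1]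
    rw [(ind_iff Z.nm R.nm).1 hi] at h0
    exact mul_ne_zero hz hω h0
  · rintro ⟨S, hS, hR⟩
    have : NeZero n := ⟨hD.pos.ne'⟩
    obtain ⟨j, hj⟩ : ∃ j : ℕ+ → Fin n, Set.InjOn j S := by
      obtain ⟨j⟩ : Nonempty (S ↪ Fin n) :=
        Function.Embedding.nonempty_of_card_le (by simpa using hS)
      refine ⟨fun x => if hx : x ∈ S then j ⟨x, hx⟩ else 0, fun x hx y hy hxy => ?_⟩
      simp only [Finset.mem_coe] at hx hy
      simp only [hx, hy, dif_pos] at hxy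
      exact congrArg Subtype.val (j.injective hxy)
    obtain ⟨C, hC, hi⟩ := exists_unif_indep R.nm hD.pos
    have hs := hC.shift R.nm hi j
    refine ⟨.of _ hs.1.nm, .of C hC.nm, sameSize_iff.2 ⟨n, hD, hs.1.isUnif⟩,
      Ind.det_left (Ind.symm hi) (of_det _), ?_⟩
    refine Det.trans (Y := fun ω => (j (R.1 ω) + C ω, C ω)) ⟨fun p => Function.invFunOn j S
      (p.1 - p.2), ?_⟩ ((det_of hs.1.nm).prod_left.prodMk (det_of hC.nm).prod_right)
    filter_upwards [hR] with ω hω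
    simp only [add_sub_cancel_right]
    exact (hj.leftInvOn_invFunOn hω).symm

theorem IsUnif.atMost_iff {R : RandVar} {m n : ℕ} (hR : IsUnif R m) : AtMost R n ↔ m ≤ n := by
  classical
  obtain ⟨A, hA, ⟨f, hf⟩, ⟨g, hg⟩⟩ := hR
  constructor
  · rintro ⟨S, hS, hae⟩
    have : (Finset.univ : Finset (Fin m)) ⊆ S.image g := by
      intro i _
      by_contra hi
      have h0 : pr {ω | A ω = i} = 0 := by
        rw [measureReal_eq_zero_iff, ← nonpos_iff_eq_zero]
        refine (measure_mono_ae (t := ∅) ?_).trans (by simp)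
        filter_upwards [hg, hae] with ω h1 h2 h3
        exact hi (Finset.mem_image.2 ⟨_, h2, h1.symm.trans h3⟩)
      rw [hA.pr_eq, one_div, inv_eq_zero] at h0
      exact hA.pos.ne' (by exact_mod_cast h0)
    calc m = (Finset.univ : Finset (Fin m)).card := by simp
      _ ≤ _ := Finset.card_le_card this
      _ ≤ _ := Finset.card_image_le
      _ ≤ n := hS
  · intro h
    refine ⟨Finset.univ.image f, Finset.card_image_le.trans (by simpa using h), ?_⟩
    filter_upwards [hf] with ω hω
    rw [hω]
    exact Finset.mem_image_of_mem _ (Finset.mem_univ _)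

/-- The number of values of `Z` is the product of those of `X` and `Y`, in terms of
independence. -/
def MulSize (X Y Z : RandVar) : Prop :=
  ∃ X' Y', SameSize X X' ∧ SameSize Y Y' ∧ Ind X'.1 Y'.1 ∧ Det X'.1 Z.1 ∧ Det Y'.1 Z.1 ∧
    Det Z.1 (fun ω => (X'.1 ω, Y'.1 ω))

theorem mulSize_iff {X Y Z : RandVar} {a b c : ℕ} (hX : IsUnif X a) (hY : IsUnif Y b)
    (hZ : IsUnif Z c) : MulSize X Y Z ↔ a * b = c := by
  constructor
  · rintro ⟨X', Y', hX', hY', hi, h1, h2, h3⟩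
    obtain ⟨n, h4, A, hA, hA1, hA2⟩ := sameSize_iff.1 hX'
    obtain rfl := hX.unique h4
    obtain ⟨n, h4, B, hB, hB1, hB2⟩ := sameSize_iff.1 hY'
    obtain rfl := hY.unique h4
    have hAB := hi.det hA2 hB2
    have hm := hA.nm.prodMk hB.nm
    have hU : Unif (fun ω => finProdFinEquiv (A ω, B ω)) := by
      refine ⟨hm.map _, fun i => ?_⟩
      have : {ω | finProdFinEquiv (A ω, B ω) = i} =
          {ω | A ω = (finProdFinEquiv.symm i).1 ∧ B ω = (finProdFinEquiv.symm i).2} := by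
        ext ω
        simp only [Set.mem_ofPred_eq]
        rw [← Equiv.eq_symm_apply, Prod.ext_iff]
      rw [this, (ind_iff hA.nm hB.nm).1 hAB, hA.pr_eq, hB.pr_eq]
      push_cast
      rw [one_div_mul_one_div]
    refine IsUnif.unique (X := Z) ⟨_, hU, ?_, ?_⟩ hZ
    · refine h3.trans (Det.trans (Y := fun ω => (A ω, B ω)) (hA1.prod_left.prodMk hB1.prod_right)
        ⟨finProdFinEquiv.symm, by simp⟩)
    · exact Det.trans (Y := fun ω => (A ω, B ω)) (.of_fun _)
        ((hA2.trans h1).prodMk (hB2.trans h2))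
  · rintro rfl
    obtain ⟨C, hC, h1, h2⟩ := hZ
    let A : unitInterval → Fin a := fun ω => (finProdFinEquiv.symm (C ω)).1
    let B : unitInterval → Fin b := fun ω => (finProdFinEquiv.symm (C ω)).2
    have hAm : NM A := hC.nm.map fun i => (finProdFinEquiv.symm i).1
    have hBm : NM B := hC.nm.map fun i => (finProdFinEquiv.symm i).2
    have ha : (a : ℝ) ≠ 0 := by exact_mod_cast hX.pos.ne'
    have hb : (b : ℝ) ≠ 0 := by exact_mod_cast hY.pos.ne'
    have hp : ∀ i j, pr {ω | A ω = i ∧ B ω = j} = 1 / a * (1 / b) := by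
      intro i j
      have : {ω | A ω = i ∧ B ω = j} = {ω | C ω = finProdFinEquiv (i, j)} := by
        ext ω
        simp only [Set.mem_ofPred_eq, A, B]
        rw [← Equiv.symm_apply_eq, Prod.ext_iff]
      rw [this, hC.pr_eq]
      push_cast
      rw [one_div_mul_one_div]
    have hA : Unif A := ⟨hAm, fun i => by
      have := (hasSum_pr_and hAm hBm i).unique (hasSum_fintype _)
      rw [this]
      simp [hp]
      field_simp⟩
    have hi : Ind A B := ind_of_forall_mul hAm hBm (q := fun _ => 1 / b) fun i j => by
      rw [hp, hA.pr_eq]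
    have hB : Unif B := ⟨hBm, pr_eq_of_forall_mul hAm hBm (q := fun _ => 1 / (b : ℝ)) fun i j => by
      rw [hp, hA.pr_eq]⟩
    refine ⟨.of A hAm, .of B hBm, sameSize_iff.2 ⟨a, hX, hA.isUnif⟩,
      sameSize_iff.2 ⟨b, hY, hB.isUnif⟩, hi.det (of_det _) (of_det _), ?_, ?_, ?_⟩
    · exact (of_det _).trans (Det.trans (.of_fun fun i => (finProdFinEquiv.symm i).1) h2)
    · exact (of_det _).trans (Det.trans (.of_fun fun i => (finProdFinEquiv.symm i).2) h2)
    · refine h1.trans (Det.trans (Y := fun ω => (A ω, B ω))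
        ⟨finProdFinEquiv, .of_forall fun ω => (finProdFinEquiv.apply_symm_apply (C ω)).symm⟩
        ((det_of hAm).prod_left.prodMk (det_of hBm).prod_right))

/-! ### Interpretation of arithmetic -/

namespace Dfn

variable {α : Type}

theorem triple (i j k : α) : Dfn (fun v => Triple (v i) (v j) (v k)) :=
  ((indep i j).and ((indep i k).and (indep j k))).and
    ((det_pair i j k).and ((det_pair j i k).and (det_pair k i j)))

theorem sameSize (i j : α) : Dfn (fun v => SameSize (v i) (v j)) :=
  ex (ex (ex ((triple (some (some (some i))) (some (some none)) (some none)).and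
    (triple (some (some (some j))) (some (some none)) none))))

theorem cardLe (i j : α) : Dfn (fun v => CardLe (v i) (v j)) :=
  ex (ex ((sameSize (some (some j)) (some none)).and ((indep none (some (some i))).and
    (det_pair (some (some i)) (some none) none))))

theorem mulSize (i j k : α) : Dfn (fun v => MulSize (v i) (v j) (v k)) :=
  ex (ex ((sameSize (some (some i)) (some none)).and ((sameSize (some (some j)) none).and
    ((indep (some none) none).and ((det (some none) (some (some k))).and
      ((det none (some (some k))).and (det_pair (some (some k)) (some none) none)))))))

end Dfn

theorem exists_isUnif (n : ℕ) : ∃ X, IsUnif X (n + 1) := by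
  obtain ⟨C, hC, -⟩ := exists_unif_indep (X := fun _ => (1 : ℕ+))
    (nm_of_fiber fun x => by by_cases h : (1 : ℕ+) = x <;> simp [h]) n.succ_pos
  exact ⟨_, hC.isUnif⟩

/-- `S` is definable in terms of independence, when a natural number `n` is represented by the
uniform random variables with `n + 1` values. -/
def NatDfn {α : Type} (S : (α → ℕ) → Prop) : Prop :=
  ∃ R : (α → RandVar) → Prop, Dfn R ∧
    ∀ v c, (∀ i, IsUnif (v i) (c i + 1)) → (R v ↔ S c)

namespace NatDfn

variable {α β : Type} {S T : (α → ℕ) → Prop}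

theorem congr (hS : NatDfn S) (h : ∀ c, S c ↔ T c) : NatDfn T := by
  obtain ⟨R, hR, hr⟩ := hS
  exact ⟨R, hR, fun v c hv => (hr v c hv).trans (h c)⟩

theorem comp (hS : NatDfn S) (g : α → β) : NatDfn (fun c : β → ℕ => S (fun a => c (g a))) := by
  obtain ⟨R, hR, hr⟩ := hS
  exact ⟨_, hR.comp g, fun v c hv => hr _ _ fun i => hv (g i)⟩

theorem false : NatDfn (fun _ : α → ℕ => False) := ⟨_, Dfn.false, fun _ _ _ => Iff.rfl⟩

theorem imp (hS : NatDfn S) (hT : NatDfn T) : NatDfn (fun c => S c → T c) := by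
  obtain ⟨R, hR, hr⟩ := hS
  obtain ⟨Q, hQ, hq⟩ := hT
  exact ⟨_, hR.imp hQ, fun v c hv => imp_congr (hr v c hv) (hq v c hv)⟩

theorem not (hS : NatDfn S) : NatDfn (fun c => ¬ S c) := hS.imp false

theorem and (hS : NatDfn S) (hT : NatDfn T) : NatDfn (fun c => S c ∧ T c) :=
  (hS.imp hT.not).not.congr fun c => by tauto

/-- Quantification over numbers is relativized to `SameSize X X`, which holds exactly for the
uniform variables; every size is realized. -/
theorem all {S : (α → ℕ) → ℕ → Prop}
    (hS : NatDfn (fun w : Option α → ℕ => S (fun a => w (some a)) (w none))) :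
    NatDfn (fun c => ∀ n, S c n) := by
  obtain ⟨R, hR, hr⟩ := hS
  refine ⟨fun v => ∀ X, SameSize X X → R (FOTPI.extend v X), Dfn.all ((Dfn.sameSize none none).imp
    (hR.congr fun w => ?_)), fun v c hv => ⟨fun h n => ?_, fun h X hX => ?_⟩⟩
  · exact iff_of_eq (congrArg R (funext fun o => by cases o <;> rfl))
  · obtain ⟨X, hX⟩ := exists_isUnif n
    exact (hr (FOTPI.extend v X) (FOTPI.extend c n) fun o => by
      cases o <;> simp [FOTPI.extend, hX, hv]).1 (h X (sameSize_self_iff.2 ⟨_, hX⟩))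
  · obtain ⟨m, hm⟩ := sameSize_self_iff.1 hX
    obtain ⟨n, rfl⟩ : ∃ n, m = n + 1 := ⟨m - 1, by have := hm.pos; omega⟩
    exact (hr (FOTPI.extend v X) (FOTPI.extend c n) fun o => by
      cases o <;> simp [FOTPI.extend, hm, hv]).2 (h n)

theorem ex {S : (α → ℕ) → ℕ → Prop}
    (hS : NatDfn (fun w : Option α → ℕ => S (fun a => w (some a)) (w none))) :
    NatDfn (fun c => ∃ n, S c n) :=
  (all (S := fun c n => ¬ S c n) hS.not).not.congr fun c => by simp

theorem le (i j : α) : NatDfn (fun c => c i ≤ c j) :=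
  ⟨_, Dfn.cardLe i j, fun _ _ hv => (cardLe_iff (hv j)).trans ((hv i).atMost_iff.trans (by simp))⟩

theorem sizeMul (i j k : α) : NatDfn (fun c => (c i + 1) * (c j + 1) = c k + 1) :=
  ⟨_, Dfn.mulSize i j k, fun _ _ hv => mulSize_iff (hv i) (hv j) (hv k)⟩

theorem eq (i j : α) : NatDfn (fun c => c i = c j) :=
  ((le i j).and (le j i)).congr fun c => by omega

theorem lt (i j : α) : NatDfn (fun c => c i < c j) :=
  (le j i).not.congr fun c => by omega

/-- The successor is the least strictly larger number, so the order suffices. -/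
theorem succ (i j : α) : NatDfn (fun c => c i + 1 = c j) :=
  ((lt i j).and (all (S := fun c n => c i < n → c j ≤ n)
    ((lt (some i) none).imp (le (some j) none)))).congr fun c =>
      ⟨fun h => by have := h.2 (c i + 1); omega, fun h => ⟨by omega, fun n hn => by omega⟩⟩

/-- Robinson's definition of addition by multiplication and the successor. -/
theorem add_eq_iff_robinson {a b c : ℕ} (hc : 0 < c) :
    (a * c + 1) * (b * c + 1) = c * c * (a * b + 1) + 1 ↔ a + b = c := by
  constructor
  · intro h
    have : (a + b) * c = c * c := by nlinarith
    exact Nat.eq_of_mul_eq_mul_right hc this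
  · rintro rfl
    ring

/-- Addition of the numbers of values. -/
theorem sizeAdd (i j k : α) : NatDfn (fun c => (c i + 1) + (c j + 1) = c k + 1) := by
  -- Robinson's equation, flattened. For the sizes `a`, `b`, `c`, the sizes coded by `p`, `q`, `r`,
  -- `s`, `t` are `ac`, `bc`, `ab`, `c²`, `c²(ab + 1)`; each prime adds one.
  have h : NatDfn (fun c : α → ℕ => ∃ p, ((c i + 1) * (c k + 1) = p + 1) ∧ ∃ p', p + 1 = p' ∧
      ∃ q, ((c j + 1) * (c k + 1) = q + 1) ∧ ∃ q', q + 1 = q' ∧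
      ∃ r, ((c i + 1) * (c j + 1) = r + 1) ∧ ∃ r', r + 1 = r' ∧
      ∃ s, ((c k + 1) * (c k + 1) = s + 1) ∧ ∃ t, ((s + 1) * (r' + 1) = t + 1) ∧
      ∃ t', t + 1 = t' ∧ (p' + 1) * (q' + 1) = t' + 1) :=
    ex ((sizeMul _ _ _).and (ex ((succ _ _).and (ex ((sizeMul _ _ _).and (ex ((succ _ _).and
      (ex ((sizeMul _ _ _).and (ex ((succ _ _).and (ex ((sizeMul _ _ _).and
        (ex ((sizeMul _ _ _).and (ex ((succ _ _).and (sizeMul _ _ _))))))))))))))))))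
  refine h.congr fun c => ?_
  rw [← add_eq_iff_robinson (Nat.succ_pos (c k))]
  constructor
  · rintro ⟨p, hp, _, rfl, q, hq, _, rfl, r, hr, _, rfl, s, hs, t, ht, _, rfl, h⟩
    simp only [Nat.succ_eq_add_one]
    rw [hp, hq, hr, hs, ht, h]
  · intro h
    obtain ⟨p, hp⟩ : ∃ p, (c i + 1) * (c k + 1) = p + 1 := ⟨_, (Nat.succ_pred (by positivity)).symm⟩
    obtain ⟨q, hq⟩ : ∃ q, (c j + 1) * (c k + 1) = q + 1 := ⟨_, (Nat.succ_pred (by positivity)).symm⟩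
    obtain ⟨r, hr⟩ : ∃ r, (c i + 1) * (c j + 1) = r + 1 := ⟨_, (Nat.succ_pred (by positivity)).symm⟩
    obtain ⟨s, hs⟩ : ∃ s, (c k + 1) * (c k + 1) = s + 1 := ⟨_, (Nat.succ_pred (by positivity)).symm⟩
    obtain ⟨t, ht⟩ : ∃ t, (s + 1) * (r + 1 + 1) = t + 1 := ⟨_, (Nat.succ_pred (by positivity)).symm⟩
    simp only [Nat.succ_eq_add_one] at h
    rw [hp, hq, hr, hs, ht] at h
    exact ⟨p, hp, _, rfl, q, hq, _, rfl, r, hr, _, rfl, s, hs, t, ht, _, rfl, h⟩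

theorem add (i j k : α) : NatDfn (fun c => c i + c j = c k) := by
  have h : NatDfn (fun c : α → ℕ => ∃ l, c k + 1 = l ∧ (c i + 1) + (c j + 1) = l + 1) :=
    ex ((succ _ _).and (sizeAdd _ _ _))
  refine h.congr fun c => ?_
  simp only [exists_eq_left']
  omega

theorem mul (i j k : α) : NatDfn (fun c => c i * c j = c k) := by
  -- Since `(x + 1)(y + 1) = (xy + x + y) + 1`, the product is `p` minus `x + y`.
  have h : NatDfn (fun c : α → ℕ => ∃ p, ((c i + 1) * (c j + 1) = p + 1) ∧
      ∃ q, c i + c j = q ∧ c k + q = p) :=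
    ex ((sizeMul _ _ _).and (ex ((add _ _ _).and (add _ _ _))))
  refine h.congr fun c => ?_
  constructor
  · rintro ⟨p, hp, q, rfl, rfl⟩
    nlinarith
  · intro h
    exact ⟨_, by rw [← h]; ring, _, rfl, rfl⟩

/-- Terms are treated through their graphs, the slot `none` holding the value, since the target
language has no functions. -/
theorem term {α : Type} (t : arith.Term α) :
    NatDfn (fun w : Option α → ℕ => t.realize (fun a => w (some a)) = w none) := by
  induction t with
  | var a => exact eq (some a) none
  | @func n f ts ih =>
    cases f with
    | add =>
      have h : NatDfn (fun w : Option α → ℕ => ∃ x, (ts 0).realize (fun a => w (some a)) = x ∧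
          ∃ y, (ts 1).realize (fun a => w (some a)) = y ∧ x + y = w none) :=
        ex (((ih 0).comp (Option.map some)).and (ex (((ih 1).comp
          (Option.map fun a => some (some a))).and (add _ _ _))))
      refine h.congr fun w => ?_
      simp only [exists_eq_left']
      rfl
    | mul =>
      have h : NatDfn (fun w : Option α → ℕ => ∃ x, (ts 0).realize (fun a => w (some a)) = x ∧
          ∃ y, (ts 1).realize (fun a => w (some a)) = y ∧ x * y = w none) :=
        ex (((ih 0).comp (Option.map some)).and (ex (((ih 1).comp
          (Option.map fun a => some (some a))).and (mul _ _ _))))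
      refine h.congr fun w => ?_
      simp only [exists_eq_left']
      rfl

theorem boundedFormula {α : Type} {n : ℕ} (φ : arith.BoundedFormula α n) :
    NatDfn (fun c : α ⊕ Fin n → ℕ => φ.Realize (fun a => c (.inl a)) (fun i => c (.inr i))) := by
  induction φ with
  | falsum => exact false
  | @equal n s t =>
    have h : NatDfn (fun c : α ⊕ Fin n → ℕ => ∃ x, s.realize c = x ∧ t.realize c = x) :=
      ex (((term s).comp fun o => o).and ((term t).comp fun o => o))
    refine h.congr fun c => ?_
    simp only [exists_eq_left']
    refine eq_comm.trans (iff_of_eq ?_)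
    change _ = (s.realize _ = t.realize _)
    congr 2 <;> (funext a; cases a <;> rfl)
  | @rel n m r ts =>
    cases r with
    | lt =>
      have h : NatDfn (fun c : α ⊕ Fin n → ℕ => ∃ x, (ts 0).realize c = x ∧
          ∃ y, (ts 1).realize c = y ∧ x < y) :=
        ex (((term (ts 0)).comp fun o => o).and (ex (((term (ts 1)).comp
          (fun o => o.elim none (fun a => some (some a)))).and (lt _ _))))
      refine h.congr fun c => ?_
      simp only [exists_eq_left']
      have hc : c = Sum.elim (fun a => c (.inl a)) (fun i => c (.inr i)) := by
        funext a; cases a <;> rfl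
      conv_lhs => rw [hc]
      rfl
  | imp _ _ ih₁ ih₂ => exact ih₁.imp ih₂
  | @all n φ ih =>
    refine all (S := fun (c : α ⊕ Fin n → ℕ) x => φ.Realize (fun a => c (.inl a))
      (Fin.snoc (fun i => c (.inr i)) x)) ?_
    refine (ih.comp (β := Option (α ⊕ Fin n)) (Sum.elim (fun a => some (.inl a))
      (Fin.lastCases (motive := fun _ => Option (α ⊕ Fin n)) none
        fun i => some (.inr i)))).congr fun w => ?_
    refine iff_of_eq (congrArg _ (funext fun i => ?_))
    refine Fin.lastCases ?_ (fun i => ?_) i <;> simp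

theorem formula {α : Type} (φ : arith.Formula α) : NatDfn φ.Realize := by
  refine ((boundedFormula φ).comp (Sum.elim id finZeroElim)).congr fun c => ?_
  exact iff_of_eq (congrArg _ (Subsingleton.elim _ _))

end NatDfn

/-! ### Random variables with two values -/

/-- The summand is the length of the part of `[d, d + 1]` lying in `[0, t]`. -/
theorem sum_clamp (t : ℝ) (ht : 0 ≤ t) (n : ℕ) :
    ∑ d ∈ Finset.range n, max 0 (min 1 (t - d)) = min t n := by
  induction n with
  | zero => simp [ht]
  | succ n ih =>
    rw [Finset.sum_range_succ, ih]
    push_cast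
    rcases le_total t n with h | h
    · rw [min_eq_left h, min_eq_left (h.trans (by linarith)), max_eq_left]
      · ring
      · exact (min_le_right _ _).trans (by linarith)
    · rw [min_eq_right h, max_eq_right (le_min zero_le_one (by linarith))]
      rcases le_total t (n + 1) with h' | h'
      · rw [min_eq_right (by linarith), min_eq_left h']; ring
      · rw [min_eq_left (by linarith), min_eq_right h']

/-- `X` takes exactly two values, with probabilities `p` and `1 - p`. -/
def TwoValued (X : RandVar) (p : ℝ) : Prop :=
  ∃ x y, x ≠ y ∧ pr {ω | X.1 ω = x} = p ∧ pr {ω | X.1 ω = y} = 1 - p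

theorem TwoValued.symm {X : RandVar} {p : ℝ} (h : TwoValued X p) : TwoValued X (1 - p) := by
  obtain ⟨x, y, hne, hx, hy⟩ := h
  exact ⟨y, x, hne.symm, hy, by rw [hx]; ring⟩

theorem pr_eq_zero_of_add_eq_one {X : RandVar} {x y : ℕ+} (hne : x ≠ y)
    (h : pr {ω | X.1 ω = x} + pr {ω | X.1 ω = y} = 1) {z : ℕ+} (hzx : z ≠ x) (hzy : z ≠ y) :
    pr {ω | X.1 ω = z} = 0 := by
  have h1 := sum_le_hasSum {x, y, z} (fun _ _ => measureReal_nonneg) (hasSum_pr_univ X.nm)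
  rw [Finset.sum_insert (by simp [hne, hzx.symm]), Finset.sum_pair hzy.symm] at h1
  have h2 : 0 ≤ pr {ω | X.1 ω = z} := measureReal_nonneg
  linarith

theorem pr_eq_zero_of_eq_one {X : RandVar} {x : ℕ+} (h : pr {ω | X.1 ω = x} = 1) {y : ℕ+}
    (hne : y ≠ x) : pr {ω | X.1 ω = y} = 0 := by
  have h1 := sum_le_hasSum {y, x} (fun _ _ => measureReal_nonneg) (hasSum_pr_univ X.nm)
  rw [Finset.sum_pair hne] at h1
  have h2 : 0 ≤ pr {ω | X.1 ω = y} := measureReal_nonneg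
  linarith

theorem atMost_one_iff {X : RandVar} : AtMost X 1 ↔ ∃ x, pr {ω | X.1 ω = x} = 1 := by
  constructor
  · rintro ⟨S, hS, hae⟩
    obtain ⟨x, hx⟩ := exists_pr_ne_zero X.nm
    refine ⟨x, ?_⟩
    have hxS : x ∈ S := by
      by_contra hxS
      refine hx ?_
      rw [measureReal_eq_zero_iff, ← nonpos_iff_eq_zero]
      refine (measure_mono_ae (t := ∅) ?_).trans (by simp)
      filter_upwards [hae] with ω h1 h2
      exact hxS (h2 ▸ h1)
    have : pr {ω | X.1 ω = x} = pr {_ω | True} := by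
      refine pr_congr ?_
      filter_upwards [hae] with ω hω
      exact iff_true_intro (Finset.card_le_one.1 hS _ hω _ hxS)
    rw [this]
    simp [pr]
  · rintro ⟨x, hx⟩
    refine ⟨{x}, by simp, ?_⟩
    filter_upwards [ae_pr_ne_zero (X := X.1)] with ω hω
    by_contra hne
    rw [Finset.mem_singleton] at hne
    exact hω (pr_eq_zero_of_eq_one hx hne)

/-- Self-independence makes each atom's mass equal to its square, hence `1`. -/
theorem ind_self_iff {X : RandVar} : Ind X.1 X.1 ↔ AtMost X 1 := by
  rw [atMost_one_iff]
  constructor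
  · intro h
    obtain ⟨x, hx⟩ := exists_pr_ne_zero X.nm
    refine ⟨x, ?_⟩
    have := (ind_iff X.nm X.nm).1 h x x
    simp only [and_self] at this
    exact mul_left_cancel₀ hx (by rw [← this, mul_one])
  · rintro ⟨x, hx⟩
    refine ind_of_forall_mul X.nm X.nm (q := fun y => if y = x then 1 else 0) fun y z => ?_
    have h0 : ∀ y, y ≠ x → pr {ω | X.1 ω = y} = 0 := fun y => pr_eq_zero_of_eq_one hx
    by_cases hy : y = x
    · by_cases hz : z = x
      · simp [hy, hz]
      · simp only [hz, if_false, mul_zero]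
        refine le_antisymm ?_ measureReal_nonneg
        rw [← h0 z hz]
        exact measureReal_mono fun ω h => h.2
    · rw [h0 y hy, zero_mul]
      refine le_antisymm ?_ measureReal_nonneg
      rw [← h0 y hy]
      exact measureReal_mono fun ω h => h.1

/-- `X` takes exactly two values, in terms of independence. -/
def Binary (X : RandVar) : Prop :=
  ¬ Ind X.1 X.1 ∧ ∀ D : RandVar, SameSize D D → ¬ Ind D.1 D.1 → CardLe X D

theorem binary_iff {X : RandVar} : Binary X ↔ ∃ p, 0 < p ∧ p < 1 ∧ TwoValued X p := by
  classical
  constructor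
  · rintro ⟨h1, h2⟩
    -- The sharpest instance: `D` has `1 + 1 = 2` values.
    obtain ⟨D, hD⟩ := exists_isUnif 1
    have hD' : ¬ Ind D.1 D.1 := by
      rw [ind_self_iff, hD.atMost_iff]
      omega
    obtain ⟨S, hS, hae⟩ := (cardLe_iff hD).1 (h2 D (sameSize_self_iff.2 ⟨_, hD⟩) hD')
    let S' := S.filter fun x => pr {ω | X.1 ω = x} ≠ 0
    have hae' : ∀ᵐ ω, X.1 ω ∈ S' := by
      filter_upwards [hae, ae_pr_ne_zero (X := X.1)] with ω h3 h4
      exact Finset.mem_filter.2 ⟨h3, h4⟩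
    have hc : S'.card = 2 := by
      have : ¬ S'.card ≤ 1 := fun h => h1 (ind_self_iff.2 ⟨S', h, hae'⟩)
      have : S'.card ≤ S.card := Finset.card_filter_le _ _
      omega
    obtain ⟨x, y, hxy, hS'⟩ := Finset.card_eq_two.1 hc
    have hx : 0 < pr {ω | X.1 ω = x} := lt_of_le_of_ne measureReal_nonneg
      (Finset.mem_filter.1 (hS' ▸ Finset.mem_insert_self x {y})).2.symm
    have hy : 0 < pr {ω | X.1 ω = y} := lt_of_le_of_ne measureReal_nonneg
      (Finset.mem_filter.1 (hS' ▸ Finset.mem_insert_of_mem (Finset.mem_singleton_self y))).2.symm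
    have hsum : pr {ω | X.1 ω = x} + pr {ω | X.1 ω = y} = 1 := by
      rw [← Finset.sum_pair (f := fun x => pr {ω | X.1 ω = x}) hxy]
      refine (HasSum.unique (hasSum_pr_univ X.nm) (hasSum_sum_of_ne_finset_zero fun z hz => ?_)).symm
      rw [measureReal_eq_zero_iff, ← nonpos_iff_eq_zero]
      refine (measure_mono_ae (t := ∅) ?_).trans (by simp)
      filter_upwards [hae'] with ω h1 h2
      exact hz (hS' ▸ h2 ▸ h1)
    exact ⟨_, hx, by linarith, x, y, hxy, rfl, by linarith⟩
  · rintro ⟨p, hp, hp1, x, y, hxy, hx, hy⟩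
    have h0 : ∀ z, z ≠ x → z ≠ y → pr {ω | X.1 ω = z} = 0 := fun z =>
      pr_eq_zero_of_add_eq_one hxy (by rw [hx, hy]; ring)
    constructor
    · rw [ind_self_iff, atMost_one_iff]
      rintro ⟨z, hz⟩
      by_cases hzx : z = x
      · rw [hzx, hx] at hz; linarith
      by_cases hzy : z = y
      · rw [hzy, hy] at hz; linarith
      rw [h0 z hzx hzy] at hz
      exact zero_ne_one hz
    · intro D hD hD'
      obtain ⟨n, hn⟩ := sameSize_self_iff.1 hD
      rw [ind_self_iff, hn.atMost_iff] at hD'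
      refine (cardLe_iff hn).2 ⟨{x, y}, by rw [Finset.card_pair hxy]; omega, ?_⟩
      filter_upwards [ae_pr_ne_zero (X := X.1)] with ω hω
      by_contra hcon
      simp only [Finset.mem_insert, Finset.mem_singleton, not_or] at hcon
      exact hω (h0 _ hcon.1 hcon.2)

/-- All values of `X` have probability at most `r / b`, where `r` and `b` are the numbers of values
of the uniform random variables `R` and `D`, in terms of independence. -/
def ProbLe (X R D : RandVar) : Prop :=
  ∃ D' T : RandVar, SameSize D D' ∧ CardLe T R ∧ Det D'.1 (fun ω => (X.1 ω, T.1 ω))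

/-- Given `X = x`, the variable `T` leaves at most `r` possible values of `D'`, so `{X = x}` is
covered by `r` events of mass `1 / b`. -/
theorem ProbLe.pr_le {X R D : RandVar} {r b : ℕ} (h : ProbLe X R D) (hR : IsUnif R r)
    (hD : IsUnif D b) (x : ℕ+) : pr {ω | X.1 ω = x} ≤ r / b := by
  classical
  obtain ⟨D', T, hDD', hT, hdet⟩ := h
  obtain ⟨n, h1, A, hA, -, hA2⟩ := sameSize_iff.1 hDD'
  obtain rfl := hD.unique h1
  obtain ⟨S, hS, hae⟩ := (cardLe_iff hR).1 hT
  obtain ⟨f, hf⟩ := hA2.trans hdet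
  let S' := S.image fun t => f (x, t)
  have hle : pr {ω | X.1 ω = x} ≤ pr (⋃ a ∈ S', {ω | A ω = a}) := by
    refine ENNReal.toReal_mono (measure_ne_top _ _) (measure_mono_ae ?_)
    filter_upwards [hf, hae] with ω h1 h2 h3
    have h3 : X.1 ω = x := h3
    rw [h3] at h1
    exact Set.mem_biUnion (Finset.mem_image_of_mem (fun t => f (x, t)) h2) h1
  calc pr {ω | X.1 ω = x} ≤ pr (⋃ a ∈ S', {ω | A ω = a}) := hle
    _ ≤ ∑ a ∈ S', pr {ω | A ω = a} := measureReal_biUnion_finset_le _ _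
    _ = S'.card / b := by simp [hA.pr_eq, div_eq_mul_inv]
    _ ≤ r / b := by
      gcongr
      exact Finset.card_image_le.trans hS

/-- Picture a uniform point of `[0, b)`, with `X = x` when it lies left of `p * b`, and let `A` be
the unit cell containing it. Each side of the cut meets at most `r` cells, so `X` and a position
counted from the outer end of its side determine `A`. -/
theorem TwoValued.probLe {X R D : RandVar} {r b : ℕ} {p : ℝ} (h : TwoValued X p) (hp0 : 0 < p)
    (hp1 : p < 1) (hR : IsUnif R r) (hD : IsUnif D b) (h1 : p ≤ r / b) (h2 : 1 - p ≤ r / b) :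
    ProbLe X R D := by
  classical
  obtain ⟨x, y, hxy, hx, hy⟩ := h
  have h0 : ∀ z, z ≠ x → z ≠ y → pr {ω | X.1 ω = z} = 0 := fun z =>
    pr_eq_zero_of_add_eq_one hxy (by rw [hx, hy]; ring)
  have hb : 0 < (b : ℝ) := by exact_mod_cast hD.pos
  have hq0 : 0 < 1 - p := by linarith
  have : Nonempty (Fin b) := ⟨⟨0, hD.pos⟩⟩
  rw [le_div_iff₀ hb] at h1 h2
  -- The part of the cell `[d, d + 1]` to the left of `p * b`.
  let φ : Fin b → ℝ := fun d => max 0 (min 1 (p * b - (d : ℕ)))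
  have hφ0 : ∀ d, 0 ≤ φ d := fun d => le_max_left _ _
  have hφ1 : ∀ d, φ d ≤ 1 := fun d => max_le zero_le_one (min_le_left _ _)
  have hsum : ∑ d, φ d = p * b := by
    rw [Fin.sum_univ_eq_sum_range (fun d => max 0 (min 1 (p * b - (d : ℕ)))) b,
      sum_clamp _ (by positivity), min_eq_left]
    nlinarith
  obtain ⟨A, hA, hAp⟩ := exists_kernel X.nm (β := Fin b)
    (fun z d => if z = x then φ d / (p * b) else (1 - φ d) / ((1 - p) * b))
    (fun z d => by
      have := hφ0 d
      have := sub_nonneg.2 (hφ1 d)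
      split_ifs <;> positivity)
    (fun z _ => by
      split_ifs
      · rw [← Finset.sum_div, hsum, div_self (by positivity)]
      · rw [← Finset.sum_div, Finset.sum_sub_distrib, hsum]
        simp only [Finset.sum_const, Finset.card_univ, Fintype.card_fin, nsmul_eq_mul, mul_one]
        rw [div_eq_one_iff_eq (by positivity)]
        ring)
  have hAx : ∀ d, pr {ω | X.1 ω = x ∧ A ω = d} = φ d / b := fun d => by
    rw [hAp, hx, if_pos rfl]
    field_simp
  have hAy : ∀ d, pr {ω | X.1 ω = y ∧ A ω = d} = (1 - φ d) / b := fun d => by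
    rw [hAp, hy, if_neg hxy.symm]
    field_simp
  have hU : Unif A := by
    refine ⟨hA, fun d => ?_⟩
    have e := (hasSum_pr_and hA X.nm d).unique (hasSum_sum_of_ne_finset_zero (s := {x, y})
      fun z hz => ?_)
    · rw [e, Finset.sum_pair hxy]
      simp only [and_comm (a := A _ = d)]
      rw [hAx, hAy]
      ring
    · simp only [Finset.mem_insert, Finset.mem_singleton, not_or] at hz
      refine le_antisymm ?_ measureReal_nonneg
      rw [← h0 z hz.1 hz.2]
      exact measureReal_mono fun ω h => h.2
  -- Cells are counted from the left end when `X = x` and from the right end otherwise; a cell of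
  -- index at least `r` in this count has no mass on its side.
  let T : unitInterval → ℕ := fun ω => if X.1 ω = x then (A ω : ℕ) else b - 1 - A ω
  have hT : NM T := (X.nm.prodMk hA).map fun q => if q.1 = x then (q.2 : ℕ) else b - 1 - q.2
  refine ⟨.of A hA, .of T hT, sameSize_iff.2 ⟨b, hD, hU.isUnif⟩, (cardLe_iff hR).2
    ⟨(Finset.range r).image (code ℕ), Finset.card_image_le.trans (by simp), ?_⟩, ?_⟩
  · filter_upwards [ae_pr_ne_zero (X := X.1),
      ae_pr_ne_zero (X := fun ω => (X.1 ω, A ω))] with ω hω hω'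
    refine Finset.mem_image_of_mem _ (Finset.mem_range.2 ?_)
    simp only [Prod.mk.injEq] at hω'
    by_cases hx' : X.1 ω = x
    · rw [hx', hAx] at hω'
      simp only [T, if_pos hx']
      by_contra hcon
      refine hω' ?_
      have : (r : ℝ) ≤ (A ω : ℕ) := by exact_mod_cast not_lt.1 hcon
      simp only [φ]
      rw [max_eq_left ((min_le_right _ _).trans (by linarith)), zero_div]
    · have hy' : X.1 ω = y := by
        by_contra hy'
        exact hω (h0 _ hx' hy')
      rw [hy', hAy] at hω'
      simp only [T, if_neg hx']
      by_contra hcon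
      refine hω' ?_
      have hlt := (A ω).2
      have h3 : r + (A ω : ℕ) + 1 ≤ b := by omega
      have : (r : ℝ) + (A ω : ℕ) + 1 ≤ b := by exact_mod_cast h3
      simp only [φ]
      rw [min_eq_left (by linarith), max_eq_right zero_le_one, sub_self, zero_div]
  · refine (of_det hA).trans (Det.trans (Y := fun ω => (X.1 ω, T ω)) (Det.trans (Z := fun ω =>
      (X.1 ω, T ω)) (Y := fun ω => if X.1 ω = x then T ω else b - 1 - T ω) ?_
      ⟨fun q => if q.1 = x then q.2 else b - 1 - q.2, by simp⟩)
      (Det.fst.prodMk (det_of hT).prod_right))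
    refine ⟨fun n => if h : n < b then ⟨n, h⟩ else A 0, .of_forall fun ω => ?_⟩
    have hlt := (A ω).2
    have : (if X.1 ω = x then T ω else b - 1 - T ω) = A ω := by
      simp only [T]
      split_ifs
      · rfl
      · omega
    simp [this]

theorem TwoValued.probLe_iff {X R D : RandVar} {r b : ℕ} {p : ℝ} (h : TwoValued X p) (hp0 : 0 < p)
    (hp1 : p < 1) (hR : IsUnif R r) (hD : IsUnif D b) :
    ProbLe X R D ↔ p ≤ r / b ∧ 1 - p ≤ r / b := by
  refine ⟨fun hX => ?_, fun hX => h.probLe hp0 hp1 hR hD hX.1 hX.2⟩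
  obtain ⟨x, y, -, hx, hy⟩ := h
  exact ⟨hx ▸ hX.pr_le hR hD x, hy ▸ hX.pr_le hR hD y⟩

/-! ### Bernoulli distributions -/

theorem bernPMF_apply (θ : unitInterval) (a : ℕ) : (bernPMF θ a).toReal =
    if a = 1 then (θ : ℝ) else if a = 0 then 1 - (θ : ℝ) else 0 := by
  classical
  rw [bernPMF, Measure.toPMF_apply, ← Measure.real,
    bernoulliMeasure_real_apply θ (MeasurableSet.singleton a)]
  rcases eq_or_ne a 1 with rfl | h1
  · simp
  · rcases eq_or_ne a 0 with rfl | h0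
    · simp
    · simp [h1, h0, h1.symm, h0.symm]

theorem followsUpToRelabelling_iff {X : RandVar} {θ : unitInterval} :
    FollowsUpToRelabelling X (bernPMF θ) ↔ ∃ f : ℕ+ → ℕ, Set.InjOn f {x | pr {ω | X.1 ω = x} ≠ 0} ∧
      ∀ a, pr {ω | f (X.1 ω) = a} =
        if a = 1 then (θ : ℝ) else if a = 0 then 1 - (θ : ℝ) else 0 := by
  have hs : X.support = {x | pr {ω | X.1 ω = x} ≠ 0} := by
    ext x
    simp [RandVar.support, measureReal_eq_zero_iff]
  unfold FollowsUpToRelabelling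
  rw [hs]
  refine exists_congr fun f => and_congr_right fun _ => forall_congr' fun a => ?_
  rw [← bernPMF_apply, pr, Measure.real, ENNReal.toReal_eq_toReal_iff' (measure_ne_top _ _)
    (PMF.apply_ne_top _ _)]

/-- Injectivity on the support prevents atoms from merging, so an atom of `f(X)` comes from a single
atom of `X`. -/
theorem exists_pr_eq_of_injOn {X : RandVar} {f : ℕ+ → ℕ}
    (hf : Set.InjOn f {x | pr {ω | X.1 ω = x} ≠ 0}) {a : ℕ} (ha : pr {ω | f (X.1 ω) = a} ≠ 0) :
    ∃ x, f x = a ∧ pr {ω | X.1 ω = x} = pr {ω | f (X.1 ω) = a} := by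
  obtain ⟨x, hx, hfx⟩ : ∃ x, pr {ω | X.1 ω = x} ≠ 0 ∧ f x = a := by
    by_contra! hcon
    refine ha ?_
    rw [measureReal_eq_zero_iff, ← nonpos_iff_eq_zero]
    refine (measure_mono_ae (t := ∅) ?_).trans (by simp)
    filter_upwards [ae_pr_ne_zero (X := X.1)] with ω h1 h2
    exact hcon _ h1 h2
  refine ⟨x, hfx, pr_congr ?_⟩
  filter_upwards [ae_pr_ne_zero (X := X.1)] with ω hω
  exact ⟨fun h => by rw [h, hfx], fun h => hf hω hx (h.trans hfx.symm)⟩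

theorem follows_zero_iff {X : RandVar} :
    FollowsUpToRelabelling X (bernPMF 0) ↔ Ind X.1 X.1 := by
  rw [followsUpToRelabelling_iff, ind_self_iff, atMost_one_iff]
  constructor
  · rintro ⟨f, hf, hp⟩
    have h0 : pr {ω | f (X.1 ω) = 0} = 1 := by simp [hp]
    obtain ⟨x, -, hx⟩ := exists_pr_eq_of_injOn hf (h0 ▸ one_ne_zero)
    exact ⟨x, hx.trans h0⟩
  · rintro ⟨x, hx⟩
    refine ⟨fun _ => 0, fun y hy z hz _ => ?_, fun a => ?_⟩
    · rw [by_contra fun h => hy (pr_eq_zero_of_eq_one hx h),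
        by_contra fun h => hz (pr_eq_zero_of_eq_one hx h)]
    · rcases eq_or_ne a 0 with rfl | ha
      · simp [pr]
      · simp [pr, ha, ha.symm]

theorem follows_iff_twoValued {X : RandVar} {θ : unitInterval} (h0 : (0 : ℝ) < θ)
    (h1 : (θ : ℝ) < 1) : FollowsUpToRelabelling X (bernPMF θ) ↔ TwoValued X θ := by
  classical
  rw [followsUpToRelabelling_iff]
  constructor
  · rintro ⟨f, hf, hp⟩
    have e1 : pr {ω | f (X.1 ω) = 1} = θ := by simp [hp]
    have e0 : pr {ω | f (X.1 ω) = 0} = 1 - θ := by simp [hp]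
    obtain ⟨x, hfx, hx⟩ := exists_pr_eq_of_injOn hf (e1 ▸ h0.ne')
    obtain ⟨y, hfy, hy⟩ := exists_pr_eq_of_injOn hf (e0 ▸ (sub_pos.2 h1).ne')
    exact ⟨x, y, fun h => by rw [h, hfy] at hfx; exact zero_ne_one hfx, hx.trans e1, hy.trans e0⟩
  · rintro ⟨x, y, hxy, hx, hy⟩
    have hz : ∀ z, pr {ω | X.1 ω = z} ≠ 0 → z ≠ x → z = y := fun z hz hzx =>
      by_contra fun hzy => hz (pr_eq_zero_of_add_eq_one hxy (by rw [hx, hy]; ring) hzx hzy)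
    refine ⟨fun z => if z = x then 1 else 0, fun z hz' w hw' h => ?_, fun a => ?_⟩
    · by_cases hzx : z = x <;> by_cases hwx : w = x
      · rw [hzx, hwx]
      · simp [hzx, hwx] at h
      · simp [hzx, hwx] at h
      · rw [hz z hz' hzx, hz w hw' hwx]
    · rcases eq_or_ne a 1 with rfl | ha1
      · rw [if_pos rfl, ← hx]
        congr 1
        ext ω
        simp
      rcases eq_or_ne a 0 with rfl | ha0
      · rw [if_neg zero_ne_one, if_pos rfl, ← hy]
        refine pr_congr ?_
        filter_upwards [ae_pr_ne_zero (X := X.1)] with ω hω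
        constructor
        · intro h
          exact hz _ hω fun hc => by simp [hc] at h
        · intro h
          simp [h, hxy.symm]
      · rw [if_neg ha1, if_neg ha0]
        have : {ω | (if X.1 ω = x then 1 else 0) = a} = ∅ := by
          ext ω
          simp only [Set.mem_ofPred_eq, Set.mem_empty_iff_false, iff_false]
          split_ifs
          · exact ha1.symm
          · exact ha0.symm
        rw [this]
        simp [pr]

/-- The numbers `(d - m) / (d + 1)` with `m < d` are exactly the fractions strictly between `0` and
`1`, which separate any two distinct points of `(0, 1/2]`. -/
theorem eq_of_forall_fraction {p q : ℝ} (hp : 0 < p) (hp' : p ≤ 1 / 2) (hq : 0 < q)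
    (hq' : q ≤ 1 / 2)
    (h : ∀ m d : ℕ, m < d → (((d - m : ℕ) : ℝ) / (d + 1 : ℕ) ≤ p ↔
      ((d - m : ℕ) : ℝ) / (d + 1 : ℕ) ≤ q)) : p = q := by
  have key : ∀ p q : ℝ, 0 < p → q ≤ 1 / 2 → (∀ m d : ℕ, m < d →
      (((d - m : ℕ) : ℝ) / (d + 1 : ℕ) ≤ q → ((d - m : ℕ) : ℝ) / (d + 1 : ℕ) ≤ p)) → q ≤ p := by
    intro p q hp hq h
    by_contra! hlt
    obtain ⟨ρ, h1, h2⟩ := exists_rat_btwn hlt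
    have hρ0 : 0 < ρ := by exact_mod_cast hp.trans h1
    have hρ1 : ρ < 1 := by
      have : (ρ : ℝ) < 1 := by linarith
      exact_mod_cast this
    have hn : 0 < ρ.num := Rat.num_pos.2 hρ0
    obtain ⟨a, ha⟩ := Int.eq_ofNat_of_zero_le hn.le
    have hden : ρ.num < ρ.den := Rat.num_lt_denom_iff.2 hρ1
    have hρ : (ρ : ℝ) = (a : ℝ) / (ρ.den : ℝ) := by
      rw [Rat.cast_def, ha]
      simp
    have e1 : ρ.den - 1 - (ρ.den - 1 - a) = a := by omega
    have e2 : ρ.den - 1 + 1 = ρ.den := by omega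
    -- Solves `d + 1 = ρ.den` and `d - m = a`.
    have := h (ρ.den - 1 - a) (ρ.den - 1) (by omega)
    rw [e1, e2, ← hρ] at this
    exact absurd (this h2.le) (not_le.2 h1)
  exact le_antisymm (key q p hq hp' fun m d hmd => (h m d hmd).1)
    (key p q hp hq' fun m d hmd => (h m d hmd).2)

theorem fraction_compl {m d : ℕ} (h : m < d) :
    ((m + 1 : ℕ) : ℝ) / (d + 1 : ℕ) = 1 - ((d - m : ℕ) : ℝ) / (d + 1 : ℕ) := by
  rw [Nat.cast_sub h.le]
  push_cast
  field_simp
  ring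

namespace Dfn

variable {α : Type}

theorem binary (i : α) : Dfn (fun v => Binary (v i)) :=
  (indep i i).not.and (all ((sameSize none none).imp ((indep none none).not.imp
    (cardLe (some i) none))))

theorem probLe (i j k : α) : Dfn (fun v => ProbLe (v i) (v j) (v k)) :=
  ex (ex ((sameSize (some (some k)) (some none)).and ((cardLe none (some (some j))).and
    (det_pair (some none) (some (some i)) none))))

end Dfn

/-- Definability of the relation `(d - m) / (d + 1) ≤ θ`. -/
theorem ArithmeticallyDefinable.natDfn {θ : ℝ} (h : ArithmeticallyDefinable θ) :
    NatDfn (fun c : Fin 2 → ℕ => c 0 < c 1 ∧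
      ((c 1 - c 0 : ℕ) : ℝ) / (c 1 + 1 : ℕ) ≤ θ) := by
  obtain ⟨φ, hφ⟩ := Set.empty_definable_iff.1 h
  have hr : ∀ c : Fin 2 → ℕ, φ.Realize c ↔
      0 < c 0 ∧ 0 < c 1 ∧ (c 0 : ℝ) / (c 1 : ℝ) ≤ θ := fun c =>
    (Set.ext_iff.1 hφ c).symm
  have hd : NatDfn (fun c : Fin 2 → ℕ => ∃ a, a + c 0 = c 1 ∧ ∃ b, c 1 + 1 = b ∧
      φ.Realize ![a, b]) :=
    .ex ((NatDfn.add _ _ _).and (.ex ((NatDfn.succ _ _).and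
      (((NatDfn.formula φ).comp ![some none, none]).congr fun w =>
        iff_of_eq (congrArg _ (funext fun i => by fin_cases i <;> rfl))))))
  refine hd.congr fun c => ?_
  simp only [exists_eq_left', hr, Matrix.cons_val_zero, Matrix.cons_val_one]
  constructor
  · rintro ⟨a, ha, h0, -, hle⟩
    have : c 1 - c 0 = a := by omega
    rw [this]
    exact ⟨by omega, hle⟩
  · rintro ⟨hlt, hle⟩
    exact ⟨c 1 - c 0, by omega, by omega, by omega, hle⟩

/-- As `p ≤ 1/2`, the binding condition in `ProbLe` is `1 - p ≤ (m + 1) / (d + 1)`, equivalent to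
`(d - m) / (d + 1) ≤ p`. The restriction `m < d` keeps the numerator positive, as the cut in
`ArithmeticallyDefinable` requires. -/
theorem TwoValued.eq_iff_forall {X : RandVar} {p θ : ℝ} (h : TwoValued X p) (hp0 : 0 < p)
    (hp1 : p ≤ 1 / 2) (hθ0 : 0 < θ) (hθ1 : θ ≤ 1 / 2) : θ = p ↔
      ∀ (m d : ℕ) (R D : RandVar), IsUnif R (m + 1) → IsUnif D (d + 1) → m < d →
        (((d - m : ℕ) : ℝ) / (d + 1 : ℕ) ≤ θ ↔ ProbLe X R D) := by
  have key : ∀ (m d : ℕ) (R D : RandVar), IsUnif R (m + 1) → IsUnif D (d + 1) → m < d →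
      (((d - m : ℕ) : ℝ) / (d + 1 : ℕ) ≤ p ↔ ProbLe X R D) := by
    intro m d R D hR hD hmd
    rw [h.probLe_iff hp0 (by linarith) hR hD, fraction_compl hmd]
    constructor
    · intro h
      constructor <;> linarith
    · rintro ⟨-, h⟩
      linarith
  constructor
  · rintro rfl
    exact key
  · intro hall
    refine eq_of_forall_fraction hθ0 hθ1 hp0 hp1 fun m d hmd => ?_
    obtain ⟨R, hR⟩ := exists_isUnif m
    obtain ⟨D, hD⟩ := exists_isUnif d
    rw [hall m d R D hR hD hmd, key m d R D hR hD hmd]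

theorem forall_isUnif_iff {P : RandVar → Prop} :
    (∀ X, SameSize X X → P X) ↔ ∀ n X, IsUnif X (n + 1) → P X := by
  simp only [sameSize_self_iff]
  constructor
  · exact fun h n X hX => h X ⟨_, hX⟩
  · rintro h X ⟨n, hn⟩
    obtain ⟨m, rfl⟩ : ∃ m, n = m + 1 := ⟨n - 1, by have := hn.pos; omega⟩
    exact h m X hn

/-- The relations `L` and `Q` that interpret `m < d` and the cut of `θ` are meaningful only on
uniform variables, hence the guards `SameSize R R` and `SameSize D D`. -/
theorem twoValued_dfn {θ : ℝ} (h0 : 0 < θ) (h1 : θ ≤ 1 / 2) (h : ArithmeticallyDefinable θ) :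
    Dfn (fun v : Fin 1 → RandVar => TwoValued (v 0) θ) := by
  obtain ⟨Q, hQ, hq⟩ := h.natDfn
  obtain ⟨L, hL, hl⟩ := NatDfn.lt (0 : Fin 2) 1
  have hdef : Dfn (fun v : Fin 1 → RandVar => Binary (v 0) ∧
      ∀ R, SameSize R R → ∀ D, SameSize D D → L ![R, D] →
        (Q ![R, D] ↔ ProbLe (v 0) R D)) := by
    have hc : ∀ {S : (Fin 2 → RandVar) → Prop}, Dfn S →
        Dfn (fun w : Option (Option (Fin 1)) → RandVar => S ![w (some none), w none]) :=
      fun hS => (hS.comp ![some none, none]).congr fun w =>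
        iff_of_eq (congrArg _ (funext fun i => by fin_cases i <;> rfl))
    exact (Dfn.binary 0).and (.all ((Dfn.sameSize none none).imp (.all ((Dfn.sameSize none none).imp
      ((hc hL).imp ((hc hQ).iff (Dfn.probLe _ _ _)))))))
  refine hdef.congr fun v => ?_
  set X := v 0
  have hiff : (∀ R, SameSize R R → ∀ D, SameSize D D → L ![R, D] →
      (Q ![R, D] ↔ ProbLe X R D)) ↔
      ∀ (m d : ℕ) (R D : RandVar), IsUnif R (m + 1) → IsUnif D (d + 1) → m < d →
        (((d - m : ℕ) : ℝ) / (d + 1 : ℕ) ≤ θ ↔ ProbLe X R D) := by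
    have e : ∀ (m d : ℕ) (R D : RandVar), IsUnif R (m + 1) → IsUnif D (d + 1) →
        ((L ![R, D] → (Q ![R, D] ↔ ProbLe X R D)) ↔
        (m < d → (((d - m : ℕ) : ℝ) / (d + 1 : ℕ) ≤ θ ↔ ProbLe X R D))) := by
      intro m d R D hR hD
      have hv : ∀ i, IsUnif (![R, D] i) (![m, d] i + 1) := by
        intro i
        fin_cases i
        exacts [hR, hD]
      rw [hl _ _ hv, hq _ _ hv]
      simp only [Matrix.cons_val_zero, Matrix.cons_val_one]
      exact forall_congr' fun hmd => by simp only [hmd, true_and]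
    simp only [forall_isUnif_iff]
    exact ⟨fun H m d R D hR hD => (e m d R D hR hD).1 (H m R hR d D hD),
      fun H m R hR d D hD => (e m d R D hR hD).2 (H m d R D hR hD)⟩
  rw [hiff, binary_iff]
  constructor
  · rintro ⟨⟨p, hp0, hp1, hX⟩, hall⟩
    -- Exchanging the two values replaces `p` by `1 - p`, so the smaller mass may be taken.
    rcases le_total p (1 / 2) with hp | hp
    · exact (hX.eq_iff_forall hp0 hp h0 h1).2 hall ▸ hX
    · exact (hX.symm.eq_iff_forall (by linarith) (by linarith) h0 h1).2 hall ▸ hX.symm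
  · intro hX
    exact ⟨⟨θ, h0, by linarith, hX⟩, (hX.eq_iff_forall h0 h1 h0 h1).1 rfl⟩

end FOTPI
end

theorem mainTheorem5 (θ : ℝ) (hθ : θ ∈ Set.Icc (0 : ℝ) (1 / 2))
    (h : FOTPI.ArithmeticallyDefinable θ) : FOTPI.BernoulliDefinable ⟨θ, hθ⟩ := by
  -- For `θ = 0` the variable is a.s. constant, which is self-independence; `TwoValued` is used only
  -- for `θ > 0`.
  rcases hθ.1.eq_or_lt with h0 | h0
  · subst h0
    obtain ⟨P, hP, hr⟩ := FOTPI.Dfn.indep (0 : Fin 1) 0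
    exact ⟨P, hP, fun X => (hr _).trans FOTPI.follows_zero_iff.symm⟩
  · obtain ⟨P, hP, hr⟩ := FOTPI.twoValued_dfn h0 hθ.2 h
    have h1 : θ < 1 := hθ.2.trans_lt (by norm_num)
    exact ⟨P, hP, fun X => (hr _).trans
      (FOTPI.follows_iff_twoValued (θ := ⟨θ, h0.le, h1.le⟩) h0 h1).symm⟩
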